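/- Write $\overline{\mathbb D}=\{z\in\mathbb C:|z|\le 1\}$. For a reproducing kernel Hilbert space $\mathcal H$ of complex-valued functions on a set $X$ with kernel $k$, let $\mathrm{Mult}(\mathcal H)$ be the algebra of all $\varphi:X\to\mathbb C$ with $\varphi f\in\mathcal H$ for every $f\in\mathcal H$, with the norm $\|\varphi\|=\|M_\varphi\|$ of the multiplication operator $M_\varphi f=\varphi f$ on $\mathcal H$; the norm of a matrix in $M_r(\mathrm{Mult}(\mathcal H))$ is that of the corresponding multiplication operator on $\mathcal H^r$. - $\mathcal H$ is a complete Pick space if for all $r,n\in\mathbb N$, $z_1,\dots,z_n\in X$ and $W_1,\dots,W_n\in M_r(\mathbb C)$, positive semidefiniteness of the block matrix $[k(z_i,z_j)(I-W_iW_j^*)]_{i,j=1}^n$ implies that there is $\Phi\in M_r(\mathrm{Mult}(\mathcal H))$ of norm at most $1$ with $\Phi(z_i)=W_i$ for all $i$. - $X$ is a maximal domain for $\mathcal H$ if every non-zero bounded linear functional $\rho$ on $\mathcal H$ such that $\rho(fg)=\rho(f)\rho(g)$ whenever $f,g,fg\in\mathcal H$ is evaluation at a point of $X$. - The one-function corona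 theorem holds for $\mathrm{Mult}(\mathcal H)$ if $1/\varphi\in\mathrm{Mult}(\mathcal H)$ for every $\varphi\in\mathrm{Mult}(\mathcal H)$ with $\inf_{x\in X}|\varphi(x)|>0$. **Theorem.** There exists a complete Pick space $\mathcal H$ on $\overline{\mathbb D}$ with reproducing kernel of the form $$k(z,w)=\sum_{n=0}^\infty a_n(z\overline w)^n\qquad(z,w\in\overline{\mathbb D}),$$ where $a_0=1$, $a_n>0$ for all $n$, $\lim_{n\to\infty}a_n/a_{n+1}=1$ and $\sum_n a_n<\infty$, such that $\overline{\mathbb D}$ is a maximal domain for $\mathcal H$ and the one-function corona theorem for $\mathrm{Mult}(\mathcal H)$ fails. In particular, $\overline{\mathbb D}$ is a proper compact subset of the maximal ideal space of $\mathrm{Mult}(\mathcal H)$: sending $z$ to evaluation at $z$ is a homeomorphism of $\overline{\mathbb D}$ onto a compact proper subset of the space of characters of $\mathrm{Mult}(\mathcal H)$ with the Gelfand topology. -/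

import Mathlib

/-- The closed unit disc in the complex plane. -/
abbrev ClosedDisc : Type := Metric.closedBall (0 : ℂ) 1

noncomputable section MultiplierAlgebra

variable {X : Type*} (H : Type*) [NormedAddCommGroup H] [InnerProductSpace ℂ H]
  [RKHS ℂ H X ℂ]

/-- The scalar kernel `k(z, w) = ⟨k_w, k_z⟩` of a Hilbert space `H` of complex-valued functions
on `X`, so that `k(·, w)` is the element of `H` that represents evaluation at `w`. -/
def scalarKernel [CompleteSpace H] (z w : X) : ℂ := RKHS.kernel H z w 1

/-- All functions `φ : X → ℂ` with `φ f ∈ H` for every `f ∈ H`, as an algebra of functions. -/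
def multiplierSubalgebra : Subalgebra ℂ (X → ℂ) where
  carrier := {φ | ∀ f : H, ∃ g : H, ∀ x, g x = φ x * f x}
  mul_mem' := by
    intro φ ψ hφ hψ f
    obtain ⟨g, hg⟩ := hψ f
    obtain ⟨h, hh⟩ := hφ g
    exact ⟨h, fun x => by simp [hh, hg, mul_assoc]⟩
  add_mem' := by
    intro φ ψ hφ hψ f
    obtain ⟨g, hg⟩ := hφ f
    obtain ⟨h, hh⟩ := hψ f
    exact ⟨g + h, fun x => by simp [hh, hg, add_mul]⟩
  algebraMap_mem' := fun c f => ⟨c • f, fun x => by simp⟩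

/-- The multiplier algebra of `H`. It is a type of its own because it carries the norm
`‖φ‖ = ‖M_φ‖` and not the topology of pointwise convergence on `X`. -/
def Mult : Type _ := multiplierSubalgebra H

namespace Mult

instance instCommRing : CommRing (Mult H) :=
  inferInstanceAs (CommRing (multiplierSubalgebra H))

instance instAlgebra : Algebra ℂ (Mult H) :=
  inferInstanceAs (Algebra ℂ (multiplierSubalgebra H))

instance instCoeFun : CoeFun (Mult H) (fun _ => X → ℂ) := ⟨fun φ => φ.1⟩

variable {H}

theorem exists_mul (φ : Mult H) (f : H) : ∃ g : H, ∀ x, g x = φ x * f x := φ.2 f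

/-- The product `φ f` of a multiplier and an element of `H`, as an element of `H`. -/
def mulFun (φ : Mult H) (f : H) : H := (φ.exists_mul f).choose

theorem mulFun_apply (φ : Mult H) (f : H) (x : X) : φ.mulFun f x = φ x * f x :=
  (φ.exists_mul f).choose_spec x

/-- Multiplication by `φ` as a linear map. -/
def mulLin (φ : Mult H) : H →ₗ[ℂ] H where
  toFun := φ.mulFun
  map_add' f g := RKHS.ext fun x => by simp [mulFun_apply, mul_add]
  map_smul' c f := RKHS.ext fun x => by simp [mulFun_apply, mul_left_comm]

variable [CompleteSpace H]

/-- The multiplication operator `M_φ`, bounded by the closed graph theorem. -/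
def mulOp (φ : Mult H) : H →L[ℂ] H :=
  ContinuousLinearMap.ofSeqClosedGraph (g := φ.mulLin) (by
    intro u f g hu hv
    refine RKHS.ext fun x => ?_
    have h1 := ((RKHS.continuous_eval (H := H) x).tendsto g).comp hv
    have h2 := (((RKHS.continuous_eval (H := H) x).tendsto f).comp hu).const_mul (φ x)
    refine tendsto_nhds_unique h1 ?_
    have : φ.mulLin f x = φ x * f x := φ.mulFun_apply f x
    rw [this]
    refine h2.congr fun n => ?_
    exact (φ.mulFun_apply (u n) x).symm)

theorem mulOp_apply (φ : Mult H) (f : H) (x : X) : φ.mulOp f x = φ x * f x :=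
  φ.mulFun_apply f x

variable (H) in
/-- The representation `φ ↦ M_φ` of the multiplier algebra on `H`. -/
def mulHom : Mult H →+* (H →L[ℂ] H) where
  toFun := mulOp
  map_one' := by
    ext f x
    rw [mulOp_apply]
    exact one_mul (f x)
  map_mul' φ ψ := by
    ext f x
    change (φ * ψ).mulOp f x = φ.mulOp (ψ.mulOp f) x
    rw [mulOp_apply, mulOp_apply, mulOp_apply]
    exact mul_assoc (φ x) (ψ x) (f x)
  map_zero' := by
    ext f x
    rw [mulOp_apply, _root_.zero_apply, RKHS.coe_zero]
    exact zero_mul (f x)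
  map_add' φ ψ := by
    ext f x
    rw [mulOp_apply, _root_.add_apply, RKHS.coe_add, Pi.add_apply, mulOp_apply,
      mulOp_apply]
    exact add_mul (φ x) (ψ x) (f x)

/-- The multiplier norm `‖φ‖ = ‖M_φ‖`. (It is a norm as soon as the kernel does not vanish on
the diagonal.) -/
instance instSeminormedCommRing : SeminormedCommRing (Mult H) :=
  { SeminormedRing.induced (Mult H) (H →L[ℂ] H) (mulHom H) with
    mul_comm := mul_comm }

theorem norm_def (φ : Mult H) : ‖φ‖ = ‖φ.mulOp‖ := rfl

/-- The operator on `H^r` (Hilbert space direct sum) of multiplication by an `r × r` matrix of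
multipliers; its operator norm is the norm of `M_r(Mult(H))`. -/
def matrixOp {r : ℕ} (Φ : Matrix (Fin r) (Fin r) (Mult H)) :
    PiLp 2 (fun _ : Fin r => H) →L[ℂ] PiLp 2 (fun _ : Fin r => H) :=
  (PiLp.continuousLinearEquiv 2 ℂ (fun _ : Fin r => H)).symm.toContinuousLinearMap ∘L
    ContinuousLinearMap.pi fun i => ∑ j, (Φ i j).mulOp ∘L PiLp.proj 2 (fun _ : Fin r => H) j

theorem matrixOp_apply {r : ℕ} (Φ : Matrix (Fin r) (Fin r) (Mult H))
    (f : PiLp 2 (fun _ : Fin r => H)) (i : Fin r) :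
    matrixOp Φ f i = ∑ j, (Φ i j).mulOp (f j) := by
  simp [matrixOp]

end Mult

variable [CompleteSpace H]

open scoped ComplexOrder in
/-- The complete Pick property: positivity of the block matrix
`[k(z_i, z_j) (I - W_i W_j^*)]` implies that the interpolation problem `Φ(z_i) = W_i`
has a solution in the closed unit ball of `M_r(Mult(H))`. -/
def IsCompletePick : Prop :=
  ∀ (r n : ℕ) (z : Fin n → X) (W : Fin n → Matrix (Fin r) (Fin r) ℂ),
    (Matrix.of fun (s t : Fin n × Fin r) =>
      scalarKernel H (z s.1) (z t.1) *
        ((1 : Matrix (Fin r) (Fin r) ℂ) - W s.1 * (W t.1).conjTranspose) s.2 t.2).PosSemidef →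
    ∃ Φ : Matrix (Fin r) (Fin r) (Mult H),
      ‖Mult.matrixOp Φ‖ ≤ 1 ∧ ∀ i p q, (Φ p q) (z i) = W i p q

variable {H} in
/-- A non-zero bounded functional with `ρ(f g) = ρ(f) ρ(g)` whenever `f`, `g` and the pointwise
product `f g` belong to `H`. -/
def IsPartiallyMultiplicative (ρ : StrongDual ℂ H) : Prop :=
  ρ ≠ 0 ∧ ∀ f g h : H, (∀ x, h x = f x * g x) → ρ h = ρ f * ρ g

/-- `X` is a maximal domain for `H`: every partially multiplicative functional is evaluation
at a point of `X`. -/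
def IsMaximalDomain : Prop :=
  ∀ ρ : StrongDual ℂ H, IsPartiallyMultiplicative ρ → ∃ x : X, ∀ f : H, ρ f = f x

/-- The one-function corona theorem for `Mult(H)`: a multiplier that is bounded below on `X`
is invertible in `Mult(H)`. -/
def OneFunctionCorona : Prop :=
  ∀ φ : Mult H, 0 < ⨅ x : X, ‖φ x‖ → ∃ ψ : Mult H, ∀ x, ψ x = 1 / φ x

/-- The maximal ideal space of `Mult(H)`: the characters of this algebra with the Gelfand
topology. -/
abbrev MaximalIdealSpace : Type _ := WeakDual.characterSpace ℂ (Mult H)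

end MultiplierAlgebra

/-! The weight `a` is a normalised superposition of geometric sequences `c j * ρ j ^ (2 * k)` with
`ρ j` increasing to 1. A mixture of geometric sequences is log-convex by Cauchy–Schwarz. By Kaluza's
lemma (`exists_renewal_of_logConvex`) the kernel is therefore `1 / (1 - ∑ b n q ^ n)` with all `b n
≥ 0`, and a lurking isometry argument gives the complete Pick property
(`isCompletePick_of_renewal`). Log-convexity, summability and `ρ j → 1` force `a k / a (k + 1) → 1`,
so a partially multiplicative functional sends `z` into the closed disc and is evaluation there
(`isMaximalDomain`).

The corona theorem is broken by `1 - g`, where `g` is a sum of windows `ρ j ^ m / n j` on `n j ≤ m <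
2 * n j`. The coefficients of `g` are nonnegative with sum at most 1/3, hence `|1 - g| ≥ 2/3` on the
disc. The `j`-th term of the mixture dominates on a block of length `(j + 1) * n j` starting at `N
j`. In the normalised basis the `j`-th window acts on that block like an average over `n j` shifts:
bounded, but with norm not made small by the smallness of its coefficients.

That `g` is a multiplier (`summable_sq_sum_entry`) follows by splitting its matrix into three
regions: before the block (Hilbert–Schmidt, because `N j` is tiny compared with `n j`), on and after
the block up to `N (j + 1)` (Schur test with entries `O(1 / n j)`), and later (entries `O(g m)`,
because the weight hardly decays over a window).

That `1 / (1 - g)` is not a multiplier (`bound_of_inverse`) follows because averaging reproduces `ρ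
j ^ k` away from the start of the block. Thus `1 - g` sends this vector on the whole block to
something dominated by its restriction to the first `2 * n j` indices. Since `1 / (1 - g)` has
nonnegative coefficients, its squared norm is at least a constant times `j + 1`. Gelfand theory
turns non-invertibility into a character vanishing at `1 - g`, which no point evaluation does. -/

/-! ### Superpositions of geometric sequences with dominating blocks. -/

/-- Parameters `ρ j, c j, N j, n j` of a superposition of geometric sequences
`∑ c j * ρ j ^ (2 * k)` in which the `j`-th term dominates on a long block starting at `N j`. -/
structure BlockSystem where
  ρ : ℕ → ℝ
  c : ℕ → ℝ
  N : ℕ → ℕ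
  n : ℕ → ℕ
  ρ_pos : ∀ j, 0 < ρ j
  ρ_lt_one : ∀ j, ρ j < 1
  ρ_step : ∀ j, 1 - ρ (j + 1) ≤ (1 - ρ j) / 2
  ρ_pow : ∀ j, 1 / 2 ≤ ρ (j + 1) ^ (4 * n j)
  c_zero : c 0 = 1
  c_pos : ∀ j, 0 < c j
  c_step : ∀ j, c (j + 1) ≤ c j * ρ j ^ (2 * (N j + (j + 1) * n j)) / 2
  c_le : ∀ j, c (j + 1) ≤ (1 / 2) ^ (j + 1) * (1 - ρ (j + 1))
  N_step : ∀ j, N j ≤ N (j + 1)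
  N_dom : ∀ j, 2 * ρ j ^ (2 * N (j + 1)) ≤ c (j + 1) * ρ (j + 1) ^ (2 * N (j + 1))
  n_pos : ∀ j, 0 < n j
  n_step : ∀ j, 2 * n j ≤ n (j + 1)
  ρ_pow_n : ∀ j, ρ j ^ n j ≤ (1 / 4) ^ (j + 1)
  N_le : ∀ j, (N j : ℝ) ≤ (1 / 4) ^ j * n j * c j * ρ j ^ (2 * N j)

-- The order of choice makes the conditions compatible: `ρ'` close to 1 in terms of the old data,
-- then `c'` so small that the new term does not disturb the old block, then `N'` so late that the
-- new term beats the old ones, and `n'` last, large compared with everything else.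
open Filter in
theorem exists_block_step (j : ℕ) (ρ c : ℝ) (N n : ℕ) (hρ : 0 < ρ) (hρ1 : ρ < 1) (hc : 0 < c) :
    ∃ (ρ' c' : ℝ) (N' n' : ℕ), 0 < ρ' ∧ ρ' < 1 ∧ 1 - ρ' ≤ (1 - ρ) / 2 ∧
      1 / 2 ≤ ρ' ^ (4 * n) ∧ 0 < c' ∧ c' ≤ c * ρ ^ (2 * (N + (j + 1) * n)) / 2 ∧
      c' ≤ (1 / 2) ^ (j + 1) * (1 - ρ') ∧ N ≤ N' ∧
      2 * ρ ^ (2 * N') ≤ c' * ρ' ^ (2 * N') ∧ 0 < n' ∧ 2 * n ≤ n' ∧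
      ρ' ^ n' ≤ (1 / 4) ^ (j + 1 + 1) ∧
      (N' : ℝ) ≤ (1 / 4) ^ (j + 1) * n' * c' * ρ' ^ (2 * N') := by
  have hlim : Tendsto (fun x : ℝ => x ^ (4 * n)) (nhdsWithin 1 (Set.Iio 1)) (nhds 1) := by
    have : ContinuousAt (fun x : ℝ => x ^ (4 * n)) 1 := by fun_prop
    simpa [ContinuousAt] using this.mono_left nhdsWithin_le_nhds
  have h1 := hlim.eventually (lt_mem_nhds (show (1 / 2 : ℝ) < 1 by norm_num))
  have h2 : ∀ᶠ x : ℝ in nhdsWithin 1 (Set.Iio 1), (1 + ρ) / 2 < x :=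
    nhdsWithin_le_nhds (lt_mem_nhds (by linarith))
  have h3 : ∀ᶠ x : ℝ in nhdsWithin 1 (Set.Iio 1), x < 1 := self_mem_nhdsWithin
  obtain ⟨ρ', hr1, hr2, hr3⟩ := (h1.and (h2.and h3)).exists
  have hρ'0 : 0 < ρ' := by linarith
  set c' : ℝ := min (c * ρ ^ (2 * (N + (j + 1) * n)) / 2) ((1 / 2) ^ (j + 1) * (1 - ρ')) with hc'
  have hc'0 : 0 < c' := by
    have : 0 < 1 - ρ' := by linarith
    apply lt_min <;> positivity
  have hq : Tendsto (fun k : ℕ => ((ρ / ρ') ^ 2) ^ k) atTop (nhds 0) := by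
    apply tendsto_pow_atTop_nhds_zero_of_lt_one (by positivity)
    have : ρ / ρ' < 1 := by rw [div_lt_one hρ'0]; linarith
    have h0 : 0 ≤ ρ / ρ' := by positivity
    nlinarith
  obtain ⟨N', hN1, hN2⟩ := ((hq.eventually (gt_mem_nhds (show (0 : ℝ) < c' / 2 by positivity))).and
    (eventually_ge_atTop N)).exists
  have hp : Tendsto (fun k : ℕ => ρ' ^ k) atTop (nhds 0) :=
    tendsto_pow_atTop_nhds_zero_of_lt_one hρ'0.le hr3
  have hp' := hp.eventually (gt_mem_nhds (show (0 : ℝ) < (1 / 4) ^ (j + 1 + 1) by positivity))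
  have hn : Tendsto (fun k : ℕ => ((1 / 4) ^ (j + 1) * c' * ρ' ^ (2 * N')) * (k : ℝ))
      atTop atTop :=
    tendsto_natCast_atTop_atTop.const_mul_atTop (by positivity)
  obtain ⟨n', hn1, hn2, hn3, hn4⟩ := (hp'.and ((hn.eventually_ge_atTop (N' : ℝ)).and
    ((eventually_ge_atTop (2 * n)).and (eventually_gt_atTop 0)))).exists
  refine ⟨ρ', c', N', n', hρ'0, hr3, by linarith, hr1.le, hc'0, min_le_left _ _,
    min_le_right _ _, hN2, ?_, hn4, hn3, hn1.le, ?_⟩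
  · rw [← pow_mul, div_pow, div_lt_iff₀ (by positivity)] at hN1
    linarith
  · calc (N' : ℝ) ≤ _ := hn2
      _ = _ := by ring

theorem exists_blockSystem : Nonempty BlockSystem := by
  let S := ℝ × ℝ × ℕ × ℕ
  let I : S → Prop := fun s => 0 < s.1 ∧ s.1 < 1 ∧ 0 < s.2.1
  have hstep : ∀ (j : ℕ) (s : {s // I s}), ∃ t : {s // I s},
      1 - t.1.1 ≤ (1 - s.1.1) / 2 ∧
      1 / 2 ≤ t.1.1 ^ (4 * s.1.2.2.2) ∧
      t.1.2.1 ≤ s.1.2.1 * s.1.1 ^ (2 * (s.1.2.2.1 + (j + 1) * s.1.2.2.2)) / 2 ∧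
      t.1.2.1 ≤ (1 / 2) ^ (j + 1) * (1 - t.1.1) ∧ s.1.2.2.1 ≤ t.1.2.2.1 ∧
      2 * s.1.1 ^ (2 * t.1.2.2.1) ≤ t.1.2.1 * t.1.1 ^ (2 * t.1.2.2.1) ∧ 0 < t.1.2.2.2 ∧
      2 * s.1.2.2.2 ≤ t.1.2.2.2 ∧
      t.1.1 ^ t.1.2.2.2 ≤ (1 / 4) ^ (j + 1 + 1) ∧
      (t.1.2.2.1 : ℝ) ≤ (1 / 4) ^ (j + 1) * t.1.2.2.2 * t.1.2.1 * t.1.1 ^ (2 * t.1.2.2.1) := by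
    rintro j ⟨⟨ρ, c, N, n⟩, h1, h2, h3⟩
    obtain ⟨ρ', c', N', n', h⟩ := exists_block_step j ρ c N n h1 h2 h3
    exact ⟨⟨(ρ', c', N', n'), h.1, h.2.1, h.2.2.2.2.1⟩, h.2.2.1, h.2.2.2.1, h.2.2.2.2.2⟩
  choose F hF using hstep
  -- The initial values `ρ = 1/2`, `n = 2` give equality in `ρ ^ n ≤ 1/4`; `N = 0` makes the bound
  -- on `N` trivial.
  let s : ℕ → {s // I s} := fun j => Nat.rec ⟨((1 / 2 : ℝ), (1 : ℝ), 0, 2), by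
    simp only [I]; norm_num⟩ F j
  have hs : ∀ j, s (j + 1) = F j (s j) := fun _ => rfl
  have h := fun j => hF j (s j)
  simp only [← hs] at h
  refine ⟨⟨fun j => (s j).1.1, fun j => (s j).1.2.1, fun j => (s j).1.2.2.1,
    fun j => (s j).1.2.2.2, fun j => (s j).2.1, fun j => (s j).2.2.1, fun j => (h j).1,
    fun j => (h j).2.1, rfl, fun j => (s j).2.2.2, fun j => (h j).2.2.1, fun j => (h j).2.2.2.1,
    fun j => (h j).2.2.2.2.1, fun j => (h j).2.2.2.2.2.1, ?_, fun j => (h j).2.2.2.2.2.2.2.1,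
    ?_, ?_⟩⟩
  · rintro (_ | j)
    · exact two_pos
    · exact (h j).2.2.2.2.2.2.1
  · rintro (_ | j)
    · change (1 / 2 : ℝ) ^ 2 ≤ _; norm_num
    · exact (h j).2.2.2.2.2.2.2.2.1
  · rintro (_ | j)
    · change ((0 : ℕ) : ℝ) ≤ (1 / 4) ^ 0 * ((2 : ℕ) : ℝ) * 1 * (1 / 2) ^ (2 * 0); norm_num
    · exact (h j).2.2.2.2.2.2.2.2.2

namespace BlockSystem

variable (B : BlockSystem)

theorem ρ_strictMono : StrictMono B.ρ :=
  strictMono_nat_of_lt_succ fun j => by linarith [B.ρ_step j, B.ρ_lt_one j]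

theorem N_mono : Monotone B.N := monotone_nat_of_le_succ B.N_step

theorem one_sub_ρ_le (j : ℕ) : 1 - B.ρ j ≤ (1 / 2) ^ j := by
  induction j with
  | zero => simpa using (B.ρ_pos 0).le
  | succ j ih => rw [pow_succ]; linarith [B.ρ_step j]

theorem c_succ_le (j : ℕ) : B.c (j + 1) ≤ B.c j / 2 := by
  refine (B.c_step j).trans ?_
  have : B.ρ j ^ (2 * (B.N j + (j + 1) * B.n j)) ≤ 1 :=
    pow_le_one₀ (B.ρ_pos j).le (B.ρ_lt_one j).le
  have := mul_le_mul_of_nonneg_left this (B.c_pos j).le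
  linarith

theorem c_add_le (j m : ℕ) : B.c (j + m) ≤ B.c j * (1 / 2) ^ m := by
  induction m with
  | zero => simp
  | succ m ih =>
    rw [pow_succ, ← add_assoc]
    linarith [B.c_succ_le (j + m)]

theorem c_le_pow (j : ℕ) : B.c j ≤ (1 / 2) ^ j := by
  simpa [B.c_zero] using B.c_add_le 0 j

theorem summable_c : Summable B.c :=
  .of_nonneg_of_le (fun j => (B.c_pos j).le) B.c_le_pow summable_geometric_two

theorem term_nonneg (k j : ℕ) : 0 ≤ B.c j * B.ρ j ^ (2 * k) :=
  mul_nonneg (B.c_pos j).le (pow_nonneg (B.ρ_pos j).le _)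

theorem term_le (k j : ℕ) : B.c j * B.ρ j ^ (2 * k) ≤ B.c j :=
  mul_le_of_le_one_right (B.c_pos j).le (pow_le_one₀ (B.ρ_pos j).le (B.ρ_lt_one j).le)

theorem summable_term (k : ℕ) : Summable fun j => B.c j * B.ρ j ^ (2 * k) :=
  .of_nonneg_of_le (B.term_nonneg k) (B.term_le k) B.summable_c

/-- The superposition `∑ c j * ρ j ^ (2 * k)`. -/
noncomputable def mix (k : ℕ) : ℝ := ∑' j, B.c j * B.ρ j ^ (2 * k)

theorem term_le_mix (k j : ℕ) : B.c j * B.ρ j ^ (2 * k) ≤ B.mix k :=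
  (B.summable_term k).le_tsum j fun i _ => B.term_nonneg k i

theorem mix_pos (k : ℕ) : 0 < B.mix k :=
  (mul_pos (B.c_pos 0) (pow_pos (B.ρ_pos 0) _)).trans_le (B.term_le_mix k 0)

theorem mix_zero_le : B.mix 0 ≤ 2 := by
  rw [← tsum_geometric_two]
  exact (B.summable_term 0).tsum_le_tsum (fun j => (B.term_le 0 j).trans (B.c_le_pow j))
    summable_geometric_two

/-- With `t` the mean of `ρ j ^ 2` under the weights `c j * ρ j ^ (2 * k)`, this is nonnegativity of
the variance. -/
theorem mix_logConvex (k : ℕ) : B.mix (k + 1) ^ 2 ≤ B.mix k * B.mix (k + 2) := by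
  set t := B.mix (k + 1) / B.mix k with ht
  have h : HasSum (fun j => B.c j * B.ρ j ^ (2 * k) * (B.ρ j ^ 2 - t) ^ 2)
      (B.mix (k + 2) - 2 * t * B.mix (k + 1) + t ^ 2 * B.mix k) := by
    have := ((B.summable_term (k + 2)).hasSum.sub
      ((B.summable_term (k + 1)).hasSum.mul_left (2 * t))).add
      ((B.summable_term k).hasSum.mul_left (t ^ 2))
    convert! this using 2 with j
    rw [show 2 * (k + 2) = 2 * k + 4 by ring, show 2 * (k + 1) = 2 * k + 2 by ring, pow_add,
      pow_add]
    ring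
  have h0 := h.nonneg fun j => mul_nonneg (B.term_nonneg k j) (sq_nonneg _)
  have hp := B.mix_pos k
  have e : t * B.mix k = B.mix (k + 1) := by rw [ht]; field_simp
  have := mul_nonneg hp.le h0
  nlinarith

/-- The earlier terms together are at most `2 * ρ (j - 1) ^ (2 * k)`. `N_dom` compares this with the
`j`-th term at `k = N j`, and the comparison persists because the `j`-th term decays more slowly. -/
theorem head_le (j k : ℕ) (hk : B.N j ≤ k) :
    ∑ i ∈ Finset.range j, B.c i * B.ρ i ^ (2 * k) ≤ B.c j * B.ρ j ^ (2 * k) := by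
  cases j with
  | zero => simpa using B.term_nonneg k 0
  | succ j =>
    have h1 : ∑ i ∈ Finset.range (j + 1), B.c i * B.ρ i ^ (2 * k) ≤
        ∑ i ∈ Finset.range (j + 1), (1 / 2 : ℝ) ^ i * B.ρ j ^ (2 * k) := by
      refine Finset.sum_le_sum fun i hi => ?_
      have : B.ρ i ≤ B.ρ j := B.ρ_strictMono.monotone (by simp at hi; omega)
      have := B.ρ_pos i
      have := B.c_le_pow i
      gcongr
    have h2 : ∑ i ∈ Finset.range (j + 1), (1 / 2 : ℝ) ^ i * B.ρ j ^ (2 * k) ≤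
        2 * B.ρ j ^ (2 * k) := by
      rw [← Finset.sum_mul]
      have := summable_geometric_two.sum_le_tsum (Finset.range (j + 1)) (fun i _ => by positivity)
      rw [tsum_geometric_two] at this
      have := pow_nonneg (B.ρ_pos j).le (2 * k)
      gcongr
    refine (h1.trans h2).trans ?_
    obtain ⟨d, rfl⟩ := Nat.exists_eq_add_of_le hk
    have h3 := B.N_dom j
    have h4 : B.ρ j ^ (2 * d) ≤ B.ρ (j + 1) ^ (2 * d) :=
      pow_le_pow_left₀ (B.ρ_pos j).le (B.ρ_strictMono.monotone (by omega)) _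
    rw [mul_add, pow_add, pow_add, ← mul_assoc, ← mul_assoc]
    exact mul_le_mul h3 h4 (pow_nonneg (B.ρ_pos j).le _) (B.term_nonneg _ _)

theorem mix_eq (j k : ℕ) : B.mix k = ∑ i ∈ Finset.range j, B.c i * B.ρ i ^ (2 * k) +
    ∑' i, B.c (i + j) * B.ρ (i + j) ^ (2 * k) :=
  ((B.summable_term k).sum_add_tsum_nat_add j).symm

theorem summable_tail (j k : ℕ) : Summable fun i => B.c (i + j) * B.ρ (i + j) ^ (2 * k) :=
  (summable_nat_add_iff j).2 (B.summable_term k)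

theorem mix_le_tail (j k : ℕ) (hk : B.N j ≤ k) :
    B.mix k ≤ 2 * ∑' i, B.c (i + j) * B.ρ (i + j) ^ (2 * k) := by
  have h2 : B.c j * B.ρ j ^ (2 * k) ≤ ∑' i, B.c (i + j) * B.ρ (i + j) ^ (2 * k) := by
    simpa using (B.summable_tail j k).le_tsum 0 fun i _ => B.term_nonneg k (i + j)
  have := B.head_le j k hk
  rw [B.mix_eq j k]
  linarith

/-- From `N j` on, the terms of index at least `j` carry half of the mass, and each of them loses at
most the factor `ρ j ^ (2 * m)` in `m` steps. -/
theorem pow_mul_mix_le (j k m : ℕ) (hk : B.N j ≤ k) :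
    B.ρ j ^ (2 * m) * B.mix k ≤ 2 * B.mix (k + m) := by
  have h1 : B.ρ j ^ (2 * m) * ∑' i, B.c (i + j) * B.ρ (i + j) ^ (2 * k) ≤
      ∑' i, B.c (i + j) * B.ρ (i + j) ^ (2 * (k + m)) := by
    rw [← tsum_mul_left]
    refine ((B.summable_tail j k).mul_left _).tsum_le_tsum (fun i => ?_) (B.summable_tail j (k + m))
    have h : B.ρ j ^ (2 * m) ≤ B.ρ (i + j) ^ (2 * m) :=
      pow_le_pow_left₀ (B.ρ_pos j).le (B.ρ_strictMono.monotone (by omega)) _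
    calc _ ≤ B.ρ (i + j) ^ (2 * m) * (B.c (i + j) * B.ρ (i + j) ^ (2 * k)) :=
          mul_le_mul_of_nonneg_right h (B.term_nonneg _ _)
      _ = _ := by rw [mul_add, pow_add]; ring
  have h2 : ∑' i, B.c (i + j) * B.ρ (i + j) ^ (2 * (k + m)) ≤ B.mix (k + m) := by
    rw [B.mix_eq j (k + m)]
    have := Finset.sum_nonneg fun i (_ : i ∈ Finset.range j) => B.term_nonneg (k + m) i
    linarith
  have h3 := mul_le_mul_of_nonneg_left (B.mix_le_tail j k hk) (pow_nonneg (B.ρ_pos j).le (2 * m))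
  linarith

/-- On the block the terms before `j`, the `j`-th term, and those after it each contribute at most
one copy of the `j`-th term; the later ones are controlled by `c_step`. -/
theorem mix_le (j k : ℕ) (hk : B.N j ≤ k) (hk' : k ≤ B.N j + (j + 1) * B.n j) :
    B.mix k ≤ 3 * (B.c j * B.ρ j ^ (2 * k)) := by
  have h1 := B.head_le j k hk
  have h2 : ∑' i, B.c (i + (j + 1)) * B.ρ (i + (j + 1)) ^ (2 * k) ≤ B.c j * B.ρ j ^ (2 * k) := by
    have h3 : ∀ i, B.c (i + (j + 1)) * B.ρ (i + (j + 1)) ^ (2 * k) ≤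
        B.c (j + 1) * (1 / 2) ^ i := fun i => by
      refine (B.term_le k _).trans ?_
      rw [add_comm]
      exact B.c_add_le (j + 1) i
    have h4 := (B.summable_tail (j + 1) k).tsum_le_tsum h3 (summable_geometric_two.mul_left _)
    rw [tsum_mul_left, tsum_geometric_two] at h4
    have h5 := B.c_step j
    have h6 : B.ρ j ^ (2 * (B.N j + (j + 1) * B.n j)) ≤ B.ρ j ^ (2 * k) :=
      pow_le_pow_of_le_one (B.ρ_pos j).le (B.ρ_lt_one j).le (by omega)
    have h7 := mul_le_mul_of_nonneg_left h6 (B.c_pos j).le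
    linarith
  rw [B.mix_eq (j + 1) k, Finset.sum_range_succ]
  linarith

/-- Summing over `k` first, the `j`-th geometric series equals `c j / (1 - ρ j ^ 2)`, which `c_le`
bounds by `2 ^ (-j)` for `j ≥ 1`. -/
theorem summable_mix : Summable B.mix := by
  have h1 : ∀ j, HasSum (fun k => B.c j * B.ρ j ^ (2 * k)) (B.c j * (1 - B.ρ j ^ 2)⁻¹) := fun j => by
    simp_rw [pow_mul]
    refine (hasSum_geometric_of_lt_one (sq_nonneg _) ?_).mul_left _
    nlinarith [B.ρ_pos j, B.ρ_lt_one j]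
  have h2 : Summable fun j => B.c j * (1 - B.ρ j ^ 2)⁻¹ := by
    rw [← summable_nat_add_iff 1]
    refine .of_nonneg_of_le (fun j => (h1 _).nonneg fun k => B.term_nonneg k _) (fun j => ?_)
      ((summable_nat_add_iff 1).2 summable_geometric_two)
    have a1 := B.ρ_pos (j + 1)
    have a2 := B.ρ_lt_one (j + 1)
    have a3 : 1 - B.ρ (j + 1) ≤ 1 - B.ρ (j + 1) ^ 2 := by nlinarith
    rw [← div_eq_mul_inv, div_le_iff₀ (by linarith)]
    refine (B.c_le j).trans ?_
    gcongr
  have h3 : Summable fun p : ℕ × ℕ => B.c p.1 * B.ρ p.1 ^ (2 * p.2) := by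
    rw [summable_prod_of_nonneg fun p => B.term_nonneg p.2 p.1]
    exact ⟨fun j => (h1 j).summable, by simpa only [(h1 _).tsum_eq] using h2⟩
  exact h3.prod_symm.prod

theorem exists_lt_ρ_sq {L : ℝ} (hL : L < 1) : ∃ j, L < B.ρ j ^ 2 := by
  obtain ⟨j, hj⟩ := exists_pow_lt_of_lt_one (show 0 < (1 - L) / 2 by linarith)
    (show (1 / 2 : ℝ) < 1 by norm_num)
  exact ⟨j, by nlinarith [B.one_sub_ρ_le j, B.ρ_pos j, B.ρ_lt_one j, sq_nonneg (1 - B.ρ j)]⟩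

end BlockSystem

/-! ### Log-convex weights and Kaluza's lemma. -/

theorem monotone_ratio_of_logConvex {a : ℕ → ℝ} (ha : ∀ k, 0 < a k)
    (h : ∀ k, a (k + 1) ^ 2 ≤ a k * a (k + 2)) : Monotone fun k => a (k + 1) / a k := by
  refine monotone_nat_of_le_succ fun k => ?_
  rw [div_le_div_iff₀ (ha _) (ha _)]
  have := h k
  nlinarith

/-- The ratios `a (k + 1) / a k` increase. A ratio above 1 would contradict summability; a bound `L
< 1` on all of them would contradict the geometric lower bound with `r > L`. -/
theorem tendsto_ratio_of_logConvex {a : ℕ → ℝ} (ha : ∀ k, 0 < a k)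
    (h : ∀ k, a (k + 1) ^ 2 ≤ a k * a (k + 2)) (hs : Summable a)
    (hr : ∀ L < 1, ∃ c r : ℝ, 0 < c ∧ L < r ∧ ∀ k, c * r ^ k ≤ a k) :
    Filter.Tendsto (fun k => a k / a (k + 1)) Filter.atTop (nhds 1) := by
  have hm := monotone_ratio_of_logConvex ha h
  have hle : ∀ k, a (k + 1) / a k ≤ 1 := fun k => by
    by_contra! hk
    have hmono : ∀ m, a k ≤ a (k + m) := fun m => by
      induction m with
      | zero => simp
      | succ m ih =>
        have := hk.le.trans (hm (Nat.le_add_right k m))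
        rw [one_le_div₀ (ha _)] at this
        exact ih.trans this
    have ht := hs.tendsto_atTop_zero
    obtain ⟨m, hm1, hm2⟩ := ((ht.eventually (gt_mem_nhds (ha k))).and
      (Filter.eventually_ge_atTop k)).exists
    obtain ⟨d, rfl⟩ := Nat.exists_eq_add_of_le hm2
    exact absurd (hmono d) (not_le.2 hm1)
  have hlim : Filter.Tendsto (fun k => a (k + 1) / a k) Filter.atTop (nhds 1) := by
    refine tendsto_order.2 ⟨fun L hL => ?_, fun L hL =>
      Filter.Eventually.of_forall fun k => (hle k).trans_lt hL⟩
    by_contra hcon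
    have hall : ∀ k, a (k + 1) / a k ≤ L := fun k => by
      by_contra! hk
      exact hcon ((Filter.eventually_ge_atTop k).mono fun m hm' => hk.trans_le (hm hm'))
    have hL0 : 0 < L := (div_pos (ha 1) (ha 0)).trans_le (hall 0)
    have hpow : ∀ k, a k ≤ a 0 * L ^ k := fun k => by
      induction k with
      | zero => simp
      | succ k ih =>
        have := hall k
        rw [div_le_iff₀ (ha k)] at this
        calc a (k + 1) ≤ L * a k := this
          _ ≤ L * (a 0 * L ^ k) := by gcongr
          _ = _ := by ring
    obtain ⟨c, r, hc, hLr, hcr⟩ := hr L hL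
    have ht := tendsto_pow_atTop_atTop_of_one_lt ((one_lt_div hL0).2 hLr)
    obtain ⟨k, hk⟩ := (ht.eventually_gt_atTop (a 0 / c)).exists
    rw [div_pow, div_lt_div_iff₀ hc (by positivity)] at hk
    have := (hcr k).trans (hpow k)
    linarith
  have := hlim.inv₀ one_ne_zero
  simpa using this

/-- A log-convex summable weight sequence `a` with `a 0 = 1`, together with blocks
`[N j, N j + (j + 1) * n j)` on which `a` is comparable to `c j * ρ j ^ (2 * k)`. -/
structure BlockWeight where
  a : ℕ → ℝ
  ρ : ℕ → ℝ
  c : ℕ → ℝ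
  N : ℕ → ℕ
  n : ℕ → ℕ
  a_zero : a 0 = 1
  a_pos : ∀ k, 0 < a k
  a_logConvex : ∀ k, a (k + 1) ^ 2 ≤ a k * a (k + 2)
  a_le_one : ∀ k, a k ≤ 1
  a_summable : Summable a
  a_ratio : Filter.Tendsto (fun k => a k / a (k + 1)) Filter.atTop (nhds 1)
  ρ_pos : ∀ j, 0 < ρ j
  ρ_lt_one : ∀ j, ρ j < 1
  ρ_pow : ∀ j, 1 / 2 ≤ ρ (j + 1) ^ (4 * n j)
  c_pos : ∀ j, 0 < c j
  N_mono : Monotone N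
  n_pos : ∀ j, 0 < n j
  n_step : ∀ j, 2 * n j ≤ n (j + 1)
  ρ_pow_n : ∀ j, ρ j ^ n j ≤ (1 / 4) ^ (j + 1)
  N_le : ∀ j, (N j : ℝ) ≤ 2 * (1 / 4) ^ j * n j * c j * ρ j ^ (2 * N j)
  le_a : ∀ j k, c j * ρ j ^ (2 * k) ≤ a k
  a_le : ∀ j k, N j ≤ k → k ≤ N j + (j + 1) * n j → a k ≤ 3 * (c j * ρ j ^ (2 * k))
  pow_mul_a_le : ∀ j k m, N j ≤ k → ρ j ^ (2 * m) * a k ≤ 2 * a (k + m)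

theorem exists_blockWeight : Nonempty BlockWeight := by
  obtain ⟨B⟩ := exists_blockSystem
  have h0 := B.mix_pos 0
  have hle : ∀ j k, B.c j / B.mix 0 * B.ρ j ^ (2 * k) ≤ B.mix k / B.mix 0 := fun j k => by
    rw [div_mul_eq_mul_div]
    exact div_le_div_of_nonneg_right (B.term_le_mix k j) h0.le
  have hlc : ∀ k, (B.mix (k + 1) / B.mix 0) ^ 2 ≤ B.mix k / B.mix 0 * (B.mix (k + 2) / B.mix 0) :=
    fun k => by
      rw [div_pow, div_mul_div_comm, ← sq]
      exact div_le_div_of_nonneg_right (B.mix_logConvex k) (by positivity)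
  have hpos : ∀ k, 0 < B.mix k / B.mix 0 := fun k => div_pos (B.mix_pos k) h0
  exact ⟨{
    a := fun k => B.mix k / B.mix 0
    ρ := B.ρ
    c := fun j => B.c j / B.mix 0
    N := B.N
    n := B.n
    a_zero := div_self h0.ne'
    a_pos := hpos
    a_logConvex := hlc
    a_le_one := fun k => by
      rw [div_le_one h0]
      refine (B.summable_term k).tsum_le_tsum (fun j => ?_) (B.summable_term 0)
      simpa using B.term_le k j
    a_summable := B.summable_mix.div_const _
    a_ratio := by
      refine tendsto_ratio_of_logConvex hpos hlc (B.summable_mix.div_const _) fun L hL => ?_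
      obtain ⟨j, hj⟩ := B.exists_lt_ρ_sq hL
      refine ⟨B.c j / B.mix 0, B.ρ j ^ 2, div_pos (B.c_pos j) h0, hj, fun k => ?_⟩
      rw [← pow_mul]
      exact hle j k
    ρ_pos := B.ρ_pos
    ρ_lt_one := B.ρ_lt_one
    ρ_pow := B.ρ_pow
    c_pos := fun j => div_pos (B.c_pos j) h0
    N_mono := B.N_mono
    n_pos := B.n_pos
    n_step := B.n_step
    ρ_pow_n := B.ρ_pow_n
    N_le := fun j => by
      refine (B.N_le j).trans ?_
      have h1 : B.c j ≤ 2 * (B.c j / B.mix 0) := by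
        rw [mul_div_assoc', le_div_iff₀ h0]
        nlinarith [B.mix_zero_le, B.c_pos j]
      have := pow_pos (B.ρ_pos j) (2 * B.N j)
      calc _ ≤ (1 / 4) ^ j * B.n j * (2 * (B.c j / B.mix 0)) * B.ρ j ^ (2 * B.N j) := by gcongr
        _ = _ := by ring
    le_a := hle
    a_le := fun j k h1 h2 => by
      rw [div_mul_eq_mul_div, mul_div_assoc']
      exact div_le_div_of_nonneg_right (B.mix_le j k h1 h2) h0.le
    pow_mul_a_le := fun j k m h => by
      rw [mul_div_assoc', mul_div_assoc']
      exact div_le_div_of_nonneg_right (B.pow_mul_mix_le j k m h) h0.le }⟩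

open Finset in
/-- Kaluza's lemma: the reciprocal of a power series with log-convex coefficients has nonpositive
higher coefficients. -/
theorem exists_renewal_of_logConvex {a : ℕ → ℝ} (h0 : a 0 = 1) (ha : ∀ k, 0 < a k)
    (h : ∀ k, a (k + 1) ^ 2 ≤ a k * a (k + 2)) :
    ∃ b : ℕ → ℝ, b 0 = 0 ∧ (∀ k, 0 ≤ b k) ∧
      ∀ k, a (k + 1) = ∑ p ∈ antidiagonal (k + 1), b p.1 * a p.2 := by
  let A : PowerSeries ℝ := PowerSeries.mk a
  let b : ℕ → ℝ := fun k => PowerSeries.coeff k (1 - A⁻¹)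
  have hA : A * A⁻¹ = 1 := PowerSeries.mul_inv_cancel _ (by simp [A, h0])
  have hbA : PowerSeries.mk b * A = A - 1 := by
    have : PowerSeries.mk b = 1 - A⁻¹ := by ext k; simp [b]
    rw [this, sub_mul, one_mul, mul_comm, hA]
  have hconv : ∀ k, a (k + 1) = ∑ p ∈ antidiagonal (k + 1), b p.1 * a p.2 := fun k => by
    have := congrArg (PowerSeries.coeff (k + 1)) hbA
    rw [PowerSeries.coeff_mul] at this
    simpa [A, PowerSeries.coeff_one] using this.symm
  have hb0 : b 0 = 0 := by
    have := congrArg (PowerSeries.coeff 0) hbA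
    rw [PowerSeries.coeff_mul] at this
    simpa [A, h0] using this
  have hm := monotone_ratio_of_logConvex ha h
  refine ⟨b, hb0, fun k => ?_, hconv⟩
  induction k using Nat.strong_induction_on with
  | _ k ih =>
    match k with
    | 0 => exact hb0.ge
    | 1 =>
      have := hconv 0
      rw [Nat.sum_antidiagonal_eq_sum_range_succ (fun i j => b i * a j)] at this
      simp [sum_range_succ, hb0, h0] at this
      rw [← this]; exact (ha 1).le
    | k + 2 =>
      have h1 := hconv k
      have h2 := hconv (k + 1)
      rw [Nat.sum_antidiagonal_eq_sum_range_succ (fun i j => b i * a j)] at h1 h2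
      rw [sum_range_succ] at h2
      simp only [Nat.sub_self, h0, mul_one] at h2
      -- Eliminating between two consecutive convolution equations expresses the next coefficient
      -- through earlier ones, with factors whose sign is that of a difference of ratios.
      have key : a (k + 1) * b (k + 2) = ∑ i ∈ range (k + 2),
          b i * (a (k + 2) * a (k + 1 - i) - a (k + 2 - i) * a (k + 1)) := by
        have : a (k + 1) * b (k + 2) =
            a (k + 2) * a (k + 1) - a (k + 1) * ∑ i ∈ range (k + 2), b i * a (k + 2 - i) := by
          rw [h2]; ring
        rw [this]
        nth_rw 1 [h1]
        rw [mul_sum, mul_sum, ← sum_sub_distrib]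
        exact sum_congr rfl fun i _ => by ring
      have hnn : 0 ≤ a (k + 1) * b (k + 2) := by
        rw [key]
        refine sum_nonneg fun i hi => mul_nonneg (ih i (by simpa using hi)) ?_
        have hi' : i ≤ k + 1 := by simp at hi; omega
        have := hm (show k + 1 - i ≤ k + 1 by omega)
        simp only at this
        rw [div_le_div_iff₀ (ha _) (ha _), show k + 1 - i + 1 = k + 2 - i by omega] at this
        linarith
      exact nonneg_of_mul_nonneg_right hnn (ha _)

/-! ### The Hilbert space of power series on the closed disc. -/

open Finset in
theorem eq_of_tsum_mul_pow_eq {u v : ℕ → ℂ} (hu : Summable fun n => ‖u n‖)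
    (hv : Summable fun n => ‖v n‖)
    (h : ∀ z : ClosedDisc, ∑' n, u n * (z : ℂ) ^ n = ∑' n, v n * (z : ℂ) ^ n) : u = v := by
  have key : ∀ {u : ℕ → ℂ}, (Summable fun n => ‖u n‖) →
      HasFPowerSeriesAt (fun z => ∑' n, u n * z ^ n) (FormalMultilinearSeries.ofScalars ℂ u) 0 := by
    intro u hu
    rw [hasFPowerSeriesAt_iff]
    filter_upwards [Metric.closedBall_mem_nhds (0 : ℂ) one_pos] with z hz
    have hz' : ‖z‖ ≤ 1 := by simpa using hz
    have hs : Summable fun n => u n * z ^ n := by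
      refine .of_norm_bounded hu fun n => ?_
      rw [norm_mul, norm_pow]
      exact mul_le_of_le_one_right (norm_nonneg _) (pow_le_one₀ (norm_nonneg _) hz')
    simpa [FormalMultilinearSeries.coeff_ofScalars, mul_comm] using hs.hasSum
  have h1 := key hu
  have h2 := (key hv).congr (g := fun z => ∑' n, u n * z ^ n) (by
    filter_upwards [Metric.closedBall_mem_nhds (0 : ℂ) one_pos] with z hz
    exact (h ⟨z, hz⟩).symm)
  have h3 := h1.eq_formalMultilinearSeries h2
  funext n
  have := congrArg (fun p => p.coeff n) h3
  simpa [FormalMultilinearSeries.coeff_ofScalars] using this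

/-- A summable positive weight sequence with `a 0 = 1`. -/
structure SummableWeight where
  a : ℕ → ℝ
  a_zero : a 0 = 1
  a_pos : ∀ k, 0 < a k
  a_summable : Summable a

/-- The Hilbert space of power series `∑ f n z ^ n` with norm `∑ ‖f n‖ ^ 2 / a n`, represented by
the coordinates with respect to the orthonormal basis `√(a n) z ^ n`. -/
def WeightedHardy (_w : SummableWeight) : Type := lp (fun _ : ℕ => ℂ) 2

theorem ClosedDisc.norm_le_one (z : ClosedDisc) : ‖(z : ℂ)‖ ≤ 1 := mem_closedBall_zero_iff.1 z.2

theorem ClosedDisc.norm_pow_le_one (z : ClosedDisc) (n : ℕ) : ‖(z : ℂ) ^ n‖ ≤ 1 := by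
  rw [norm_pow]; exact pow_le_one₀ (norm_nonneg _) z.norm_le_one

theorem ClosedDisc.summable_mul_pow (z : ClosedDisc) {u : ℕ → ℂ} (hu : Summable fun n => ‖u n‖) :
    Summable fun n => ‖u n * (z : ℂ) ^ n‖ := by
  refine .of_nonneg_of_le (fun _ => norm_nonneg _) (fun n => ?_) hu
  rw [norm_mul]
  exact mul_le_of_le_one_right (norm_nonneg _) (z.norm_pow_le_one n)

namespace WeightedHardy

variable {w : SummableWeight}

noncomputable instance : NormedAddCommGroup (WeightedHardy w) :=
  inferInstanceAs (NormedAddCommGroup (lp (fun _ : ℕ => ℂ) 2))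

noncomputable instance : InnerProductSpace ℂ (WeightedHardy w) :=
  inferInstanceAs (InnerProductSpace ℂ (lp (fun _ : ℕ => ℂ) 2))

instance : CompleteSpace (WeightedHardy w) :=
  inferInstanceAs (CompleteSpace (lp (fun _ : ℕ => ℂ) 2))

/-- The Taylor coefficients of an element of the space. -/
noncomputable def coeff (f : WeightedHardy w) (n : ℕ) : ℂ := (√(w.a n) : ℂ) * f.1 n

theorem _root_.SummableWeight.sqrt_pos (w : SummableWeight) (n : ℕ) : 0 < √(w.a n) :=
  Real.sqrt_pos.2 (w.a_pos n)

theorem norm_coeff_sq (f : WeightedHardy w) (n : ℕ) :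
    ‖f.coeff n‖ ^ 2 / w.a n = ‖f.1 n‖ ^ 2 := by
  rw [coeff, norm_mul, mul_pow, Complex.norm_real, Real.norm_eq_abs, sq_abs,
    Real.sq_sqrt (w.a_pos n).le]
  field_simp [(w.a_pos n).ne']

theorem hasSum_norm_coeff_sq (f : WeightedHardy w) :
    HasSum (fun n => ‖f.coeff n‖ ^ 2 / w.a n) (‖f‖ ^ 2) := by
  simp_rw [norm_coeff_sq]
  have h := lp.hasSum_norm (p := 2) (by norm_num) (f : lp (fun _ : ℕ => ℂ) 2)
  simpa using! h

theorem exists_coeff_eq (u : ℕ → ℂ) (hu : Summable fun n => ‖u n‖ ^ 2 / w.a n) :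
    ∃ f : WeightedHardy w, f.coeff = u := by
  have hm : Memℓp (fun n => u n / (√(w.a n) : ℂ)) 2 := by
    rw [memℓp_gen_iff (by norm_num)]
    refine hu.congr fun n => ?_
    simp [div_pow, Real.sq_sqrt (w.a_pos n).le]
  refine ⟨(⟨_, hm⟩ : lp (fun _ : ℕ => ℂ) 2), funext fun n => ?_⟩
  have : (√(w.a n) : ℂ) ≠ 0 := by exact_mod_cast (w.sqrt_pos n).ne'
  change (√(w.a n) : ℂ) * (u n / (√(w.a n) : ℂ)) = u n
  field_simp

theorem coeff_injective : Function.Injective (coeff : WeightedHardy w → ℕ → ℂ) := by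
  intro f g h
  refine Subtype.ext (funext fun n => ?_)
  have : (√(w.a n) : ℂ) ≠ 0 := by exact_mod_cast (w.sqrt_pos n).ne'
  exact mul_left_cancel₀ this (congrFun h n)

theorem summable_norm_coeff (f : WeightedHardy w) : Summable fun n => ‖f.coeff n‖ := by
  have h := (w.a_summable.add f.hasSum_norm_coeff_sq.summable)
  refine .of_nonneg_of_le (fun _ => norm_nonneg _) (fun n => ?_) h
  rw [norm_coeff_sq, coeff, norm_mul, Complex.norm_real, Real.norm_eq_abs,
    abs_of_pos (w.sqrt_pos n)]
  -- This is `s * t ≤ s ^ 2 + t ^ 2` with `s = √(a n)`.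
  nlinarith [Real.sq_sqrt (w.a_pos n).le, sq_nonneg (√(w.a n) - ‖f.1 n‖),
    sq_nonneg (√(w.a n)), sq_nonneg ‖f.1 n‖]

theorem memℓp_kernelVec (z : ClosedDisc) :
    Memℓp (fun n => (√(w.a n) : ℂ) * star (z : ℂ) ^ n) 2 := by
  rw [memℓp_gen_iff (by norm_num)]
  refine .of_nonneg_of_le (fun n => by positivity) (fun n => ?_) w.a_summable
  have h := z.norm_pow_le_one n
  simp only [norm_mul, norm_pow, norm_star, Complex.norm_real, Real.norm_eq_abs] at h ⊢
  rw [abs_of_pos (w.sqrt_pos n)]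
  simp only [ENNReal.toReal_ofNat, Real.rpow_ofNat]
  rw [mul_pow, Real.sq_sqrt (w.a_pos n).le]
  exact mul_le_of_le_one_right (w.a_pos n).le (pow_le_one₀ (by positivity) h)

/-- The element representing evaluation at a point of the disc. -/
noncomputable def kernelVec (z : ClosedDisc) : WeightedHardy w :=
  (⟨_, memℓp_kernelVec (w := w) z⟩ : lp (fun _ : ℕ => ℂ) 2)

theorem kernelVec_val (z : ClosedDisc) (n : ℕ) :
    (kernelVec z : WeightedHardy w).1 n = (√(w.a n) : ℂ) * star (z : ℂ) ^ n := rfl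

theorem inner_kernelVec (z : ClosedDisc) (f : WeightedHardy w) :
    inner ℂ (kernelVec z) f = ∑' n, f.coeff n * (z : ℂ) ^ n := by
  have h : inner ℂ (kernelVec z) f = ∑' n, inner ℂ ((kernelVec z : WeightedHardy w).1 n) (f.1 n) :=
    lp.inner_eq_tsum (𝕜 := ℂ) (G := fun _ : ℕ => ℂ) _ _
  rw [h]
  refine tsum_congr fun n => ?_
  simp [kernelVec_val, coeff]
  ring

noncomputable instance : RKHS ℂ (WeightedHardy w) ClosedDisc ℂ where
  coeCLM := ContinuousLinearMap.pi fun z => innerSL ℂ (kernelVec z)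
  coeCLM_injective := by
    intro f g h
    refine coeff_injective (eq_of_tsum_mul_pow_eq f.summable_norm_coeff g.summable_norm_coeff
      fun z => ?_)
    rw [← inner_kernelVec, ← inner_kernelVec]
    exact congrFun h z

theorem apply_eq_inner (f : WeightedHardy w) (z : ClosedDisc) : f z = inner ℂ (kernelVec z) f := rfl

theorem apply_eq_tsum (f : WeightedHardy w) (z : ClosedDisc) :
    f z = ∑' n, f.coeff n * (z : ℂ) ^ n := by
  rw [apply_eq_inner, inner_kernelVec]

theorem hasSum_apply (f : WeightedHardy w) (z : ClosedDisc) :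
    HasSum (fun n => f.coeff n * (z : ℂ) ^ n) (f z) := by
  rw [apply_eq_tsum]
  exact (z.summable_mul_pow f.summable_norm_coeff).of_norm.hasSum

theorem kerFun_one (z : ClosedDisc) : RKHS.kerFun (WeightedHardy w) z 1 = kernelVec z := by
  refine ext_inner_right ℂ fun f => ?_
  rw [RKHS.kerFun_inner, ← apply_eq_inner]
  simp

theorem hasSum_scalarKernel (z t : ClosedDisc) :
    HasSum (fun n => (w.a n : ℂ) * ((z : ℂ) * star (t : ℂ)) ^ n)
      (scalarKernel (WeightedHardy w) z t) := by
  rw [scalarKernel, ← RKHS.kerFun_apply, kerFun_one]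
  convert! hasSum_apply (kernelVec t) z using 2 with n
  have h : (√(w.a n) : ℂ) * √(w.a n) = w.a n := by
    exact_mod_cast Real.mul_self_sqrt (w.a_pos n).le
  rw [coeff, kernelVec_val, ← mul_assoc, h, mul_pow]
  ring

theorem continuous_apply (f : WeightedHardy w) : Continuous fun z : ClosedDisc => f z := by
  simp_rw [apply_eq_tsum]
  refine continuous_tsum (fun n => by fun_prop) f.summable_norm_coeff fun n z => ?_
  rw [norm_mul]
  exact mul_le_of_le_one_right (norm_nonneg _) (z.norm_pow_le_one n)

-- Pointwise products become convolutions of coefficients, so multiplier questions turn into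
-- questions about lower triangular matrices.
open Finset in
theorem forall_apply_eq_mul_iff {u : ℕ → ℂ} (hu : Summable fun n => ‖u n‖)
    (h f : WeightedHardy w) :
    (∀ z : ClosedDisc, h z = (∑' n, u n * (z : ℂ) ^ n) * f z) ↔
      ∀ n, h.coeff n = ∑ p ∈ antidiagonal n, u p.1 * f.coeff p.2 := by
  have key : ∀ z : ClosedDisc, (∑' n, u n * (z : ℂ) ^ n) * f z =
      ∑' n, (∑ p ∈ antidiagonal n, u p.1 * f.coeff p.2) * (z : ℂ) ^ n := fun z => by
    rw [apply_eq_tsum, tsum_mul_tsum_eq_tsum_sum_antidiagonal_of_summable_norm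
      (z.summable_mul_pow hu) (z.summable_mul_pow f.summable_norm_coeff)]
    refine tsum_congr fun n => ?_
    rw [sum_mul]
    refine sum_congr rfl fun p hp => ?_
    rw [← mem_antidiagonal.1 hp, pow_add]
    ring
  have hs := summable_norm_sum_mul_antidiagonal_of_summable_norm hu f.summable_norm_coeff
  constructor
  · intro H
    refine congrFun (eq_of_tsum_mul_pow_eq h.summable_norm_coeff hs fun z => ?_)
    rw [← key, ← H, apply_eq_tsum]
  · intro H z
    rw [key, apply_eq_tsum]
    simp_rw [H]

end WeightedHardy

/-! ### Monomials and the maximal domain. -/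

namespace WeightedHardy

variable {w : SummableWeight}

theorem exists_monomial (k : ℕ) : ∃ f : WeightedHardy w, f.coeff = Pi.single k 1 :=
  exists_coeff_eq _ (summable_of_ne_finset_zero (s := {k}) fun n hn => by
    have : n ≠ k := by simpa using hn
    simp [this])

/-- The monomial `z ^ k`. -/
noncomputable def monomial (k : ℕ) : WeightedHardy w := (exists_monomial k).choose

theorem coeff_monomial (k : ℕ) : (monomial k : WeightedHardy w).coeff = Pi.single k 1 :=
  (exists_monomial k).choose_spec

theorem monomial_apply (k : ℕ) (z : ClosedDisc) :
    (monomial k : WeightedHardy w) z = (z : ℂ) ^ k := by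
  rw [apply_eq_tsum, coeff_monomial, tsum_eq_single k]
  · simp
  · intro n hn
    simp [hn]

theorem norm_monomial_sq (k : ℕ) : ‖(monomial k : WeightedHardy w)‖ ^ 2 = 1 / w.a k := by
  rw [← (hasSum_norm_coeff_sq _).tsum_eq, tsum_eq_single k]
  · simp [coeff_monomial]
  · intro n hn
    simp [coeff_monomial, hn]

theorem eq_zero_of_forall_monomial {F : Type*} [NormedAddCommGroup F] [NormedSpace ℂ F]
    (T : WeightedHardy w →L[ℂ] F) (hT : ∀ k, T (monomial k) = 0) : T = 0 := by
  have hc : (Submodule.span ℂ (Set.range (monomial : ℕ → WeightedHardy w))).topologicalClosure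
      = ⊤ := by
    rw [Submodule.topologicalClosure_eq_top_iff, Submodule.eq_bot_iff]
    intro f hf
    refine coeff_injective (funext fun k => ?_)
    have h := (Submodule.mem_orthogonal _ f).1 hf _ (Submodule.subset_span ⟨k, rfl⟩)
    have h' : inner ℂ (monomial k : WeightedHardy w) f =
        ∑' n, inner ℂ ((monomial k : WeightedHardy w).1 n) (f.1 n) :=
      lp.inner_eq_tsum (𝕜 := ℂ) (G := fun _ : ℕ => ℂ) _ _
    have h1 : ∀ n, (monomial k : WeightedHardy w).coeff n =
        (√(w.a n) : ℂ) * (monomial k : WeightedHardy w).1 n := fun n => rfl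
    have hne : ∀ n, (√(w.a n) : ℂ) ≠ 0 := fun n => by exact_mod_cast (w.sqrt_pos n).ne'
    have h2 : ∀ n, n ≠ k → (monomial k : WeightedHardy w).1 n = 0 := fun n hn => by
      have := h1 n
      rw [coeff_monomial, Pi.single_eq_of_ne hn] at this
      exact (mul_eq_zero.1 this.symm).resolve_left (hne n)
    have h3 : (monomial k : WeightedHardy w).1 k ≠ 0 := fun h0 => by
      have := h1 k
      rw [coeff_monomial, Pi.single_eq_same, h0, mul_zero] at this
      exact one_ne_zero this
    rw [h', tsum_eq_single k fun n hn => by rw [h2 n hn, inner_zero_left]] at h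
    have h4 : f.1 k = 0 := by
      rw [RCLike.inner_apply, mul_eq_zero] at h
      exact h.resolve_right fun h0 => h3 ((map_eq_zero _).1 h0)
    change (√(w.a k) : ℂ) * f.1 k = (√(w.a k) : ℂ) * 0
    rw [h4]
  have hle : (Submodule.span ℂ (Set.range (monomial : ℕ → WeightedHardy w))).topologicalClosure ≤
      T.ker :=
    Submodule.topologicalClosure_minimal _ (Submodule.span_le.2 (by rintro _ ⟨k, rfl⟩; exact hT k))
      T.isClosed_ker
  ext f
  exact hle (hc ▸ Submodule.mem_top)

/-- If `1 < y < x`, then eventually `a (n + 1) ≥ a n / y`, so `a n * x ^ n` grows at least like `(x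
/ y) ^ n`. -/
theorem norm_le_one_of_forall_pow_le (hr : Filter.Tendsto (fun n => w.a n / w.a (n + 1)) Filter.atTop
    (nhds 1)) {x C : ℝ} (h : ∀ n, w.a n * x ^ n ≤ C) : x ≤ 1 := by
  by_contra! hx1
  obtain ⟨y, hy1, hyx⟩ := exists_between hx1
  have hy0 : 0 < y := one_pos.trans hy1
  obtain ⟨m, hm⟩ := Filter.eventually_atTop.1 (hr.eventually (gt_mem_nhds hy1))
  have hgrow : ∀ d, w.a m * x ^ m * (x / y) ^ d ≤ w.a (m + d) * x ^ (m + d) := fun d => by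
    induction d with
    | zero => simp
    | succ d ih =>
      have h1 := hm (m + d) (by omega)
      rw [div_lt_iff₀ (w.a_pos _)] at h1
      have h2 : w.a (m + d) / y ≤ w.a (m + d + 1) := by
        rw [div_le_iff₀ hy0]; linarith
      have hxp : 0 ≤ x ^ (m + d) * x := by positivity
      calc w.a m * x ^ m * (x / y) ^ (d + 1)
          = w.a m * x ^ m * (x / y) ^ d * (x / y) := by ring
        _ ≤ w.a (m + d) * x ^ (m + d) * (x / y) := by gcongr
        _ = w.a (m + d) / y * (x ^ (m + d) * x) := by ring
        _ ≤ w.a (m + d + 1) * (x ^ (m + d) * x) := by gcongr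
        _ = _ := by rw [← pow_succ, add_assoc]
  have hc : 0 < w.a m * x ^ m := mul_pos (w.a_pos m) (by positivity)
  have ht := (tendsto_pow_atTop_atTop_of_one_lt ((one_lt_div hy0).2 hyx)).const_mul_atTop hc
  obtain ⟨d, hd⟩ := (ht.eventually_gt_atTop C).exists
  linarith [hgrow d, h (m + d)]

theorem isMaximalDomain (hr : Filter.Tendsto (fun n => w.a n / w.a (n + 1)) Filter.atTop
    (nhds 1)) : IsMaximalDomain (WeightedHardy w) := by
  intro ρ ⟨hρ0, hρ⟩
  have h1 : ρ (monomial 0) = 1 := by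
    obtain ⟨f, hf⟩ : ∃ f, ρ f ≠ 0 := by
      by_contra! hcon
      exact hρ0 (ContinuousLinearMap.ext hcon)
    have := hρ f (monomial 0) f fun x => by simp [monomial_apply]
    exact mul_left_cancel₀ hf (by rw [← this, mul_one])
  have hpow : ∀ k, ρ (monomial k) = ρ (monomial 1) ^ k := fun k => by
    induction k with
    | zero => simpa using h1
    | succ k ih =>
      rw [pow_succ, ← ih]
      exact hρ _ _ _ fun x => by simp [monomial_apply, pow_succ]
  -- Boundedness on `z ^ n`, whose squared norm is `1 / a n`, confines the image of `z` to the
  -- closed disc.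
  have hle : ‖ρ (monomial 1)‖ ^ 2 ≤ 1 := by
    refine norm_le_one_of_forall_pow_le hr (C := ‖ρ‖ ^ 2) fun n => ?_
    have h2 := ρ.le_opNorm (monomial n)
    rw [hpow, norm_pow] at h2
    have h3 := pow_le_pow_left₀ (by positivity) h2 2
    rw [mul_pow, norm_monomial_sq, mul_one_div, le_div_iff₀ (w.a_pos n), ← pow_mul] at h3
    rw [← pow_mul, mul_comm 2 n]
    linarith
  have hle' : ‖ρ (monomial 1)‖ ≤ 1 := by
    rwa [sq_le_one_iff₀ (norm_nonneg _)] at hle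
  let z : ClosedDisc := ⟨ρ (monomial 1), mem_closedBall_zero_iff.2 hle'⟩
  refine ⟨z, fun f => ?_⟩
  have := eq_zero_of_forall_monomial (ρ - innerSL ℂ (kernelVec z)) fun k => by
    rw [_root_.sub_apply, hpow, sub_eq_zero]
    exact (monomial_apply k z).symm
  exact congrArg (fun T : StrongDual ℂ (WeightedHardy w) => T f) (sub_eq_zero.1 this)

end WeightedHardy

/-! ### The multiplier algebra as a Banach algebra and its characters. -/

namespace Mult

variable {X : Type*} {H : Type*} [NormedAddCommGroup H] [InnerProductSpace ℂ H]
  [RKHS ℂ H X ℂ] [CompleteSpace H]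

/-- The kernel function at `x` is a nonzero eigenvector of the adjoint of `M_φ`, with eigenvalue the
conjugate of `φ x`. -/
theorem norm_apply_le (hker : ∀ x : X, ∃ f : H, f x ≠ 0) (φ : Mult H) (x : X) : ‖φ x‖ ≤ ‖φ‖ := by
  obtain ⟨f, hf⟩ := hker x
  set k := RKHS.kerFun H x (1 : ℂ) with hk
  have h0 : k ≠ 0 := fun h => hf (by
    have := RKHS.kerFun_inner x (1 : ℂ) f
    rw [← hk, h] at this
    simpa using this.symm)
  have h1 : (φ.mulOp).adjoint k = star (φ x) • k := by
    refine ext_inner_right ℂ fun g => ?_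
    rw [ContinuousLinearMap.adjoint_inner_left, hk, RKHS.kerFun_inner, inner_smul_left,
      RKHS.kerFun_inner, mulOp_apply]
    simp
  have h2 := (φ.mulOp).adjoint.le_opNorm k
  rw [h1, norm_smul, norm_star, LinearIsometryEquiv.norm_map] at h2
  exact le_of_mul_le_mul_right h2 (norm_pos_iff.2 h0)

variable (H) in
/-- The multiplier norm is a norm when the functions in `H` have no common zero. -/
noncomputable abbrev normedCommRing (hker : ∀ x : X, ∃ f : H, f x ≠ 0) : NormedCommRing (Mult H) :=
  { (inferInstance : SeminormedCommRing (Mult H)) with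
    eq_of_dist_eq_zero := by
      intro φ ψ h
      rw [dist_eq_norm] at h
      refine Subtype.ext (funext fun x => ?_)
      have := (norm_apply_le hker (φ - ψ) x).trans_eq h
      exact sub_eq_zero.1 (norm_le_zero_iff.1 this) }

theorem mulOp_smul (c : ℂ) (φ : Mult H) : (c • φ).mulOp = c • φ.mulOp := by
  ext f x
  rw [mulOp_apply, _root_.smul_apply, RKHS.coe_smul, Pi.smul_apply, mulOp_apply]
  exact smul_mul_assoc c (φ x) (f x)

/-- A Cauchy sequence converges both in operator norm and pointwise; continuity of evaluations
identifies the limit operator with multiplication by the pointwise limit. -/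
theorem completeSpace (hker : ∀ x : X, ∃ f : H, f x ≠ 0) : CompleteSpace (Mult H) := by
  refine Metric.complete_of_cauchySeq_tendsto fun u hu => ?_
  have hev : ∀ x, CauchySeq fun n => u n x := fun x => by
    refine Metric.cauchySeq_iff'.2 fun ε hε => ?_
    obtain ⟨N, hN⟩ := Metric.cauchySeq_iff'.1 hu ε hε
    refine ⟨N, fun n hn => lt_of_le_of_lt ?_ (hN n hn)⟩
    rw [dist_eq_norm, dist_eq_norm]
    exact norm_apply_le hker (u n - u N) x
  have hop : CauchySeq fun n => (u n).mulOp := by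
    refine Metric.cauchySeq_iff'.2 fun ε hε => ?_
    obtain ⟨N, hN⟩ := Metric.cauchySeq_iff'.1 hu ε hε
    refine ⟨N, fun n hn => lt_of_le_of_lt (le_of_eq ?_) (hN n hn)⟩
    rw [dist_eq_norm, dist_eq_norm, norm_def]
    exact congrArg norm ((mulHom H).map_sub (u n) (u N)).symm
  obtain ⟨T, hT⟩ := cauchySeq_tendsto_of_complete hop
  choose φ hφ using fun x => cauchySeq_tendsto_of_complete (hev x)
  have hTφ : ∀ f x, T f x = φ x * f x := fun f x => by
    have h1 : Filter.Tendsto (fun n => (u n).mulOp f x) Filter.atTop (nhds (T f x)) :=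
      ((RKHS.continuous_eval (H := H) x).tendsto _).comp
        (((ContinuousLinearMap.apply ℂ H f).continuous.tendsto T).comp hT)
    refine tendsto_nhds_unique h1 ?_
    simp_rw [mulOp_apply]
    exact (hφ x).mul_const _
  let Φ : Mult H := ⟨φ, fun f => ⟨T f, hTφ f⟩⟩
  have hΦ : Φ.mulOp = T := by
    ext f x
    rw [mulOp_apply, hTφ]
  refine ⟨Φ, ?_⟩
  rw [tendsto_iff_norm_sub_tendsto_zero] at hT ⊢
  refine hT.congr fun n => ?_
  rw [← hΦ, norm_def]
  exact congrArg norm ((mulHom H).map_sub (u n) Φ).symm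

/-- In a commutative complex Banach algebra every non-invertible element is killed by some
character. Nonvanishing of `φ` identifies an algebra inverse with `1 / φ`. -/
theorem exists_character_eq_zero (hker : ∀ x : X, ∃ f : H, f x ≠ 0) (φ : Mult H)
    (hφ : ¬ ∃ ψ : Mult H, ∀ x, ψ x = 1 / φ x) (hφ0 : ∀ x, φ x ≠ 0) :
    ∃ χ : MaximalIdealSpace H, χ φ = 0 := by
  let := normedCommRing H hker
  let : NormedAlgebra ℂ (Mult H) :=
    { (inferInstance : Algebra ℂ (Mult H)) with
      norm_smul_le := fun c φ => by
        change ‖(c • φ).mulOp‖ ≤ ‖c‖ * ‖φ.mulOp‖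
        rw [mulOp_smul, norm_smul] }
  have := completeSpace (H := H) hker
  refine WeakDual.CharacterSpace.exists_apply_eq_zero fun hu => hφ ?_
  obtain ⟨ψ, hψ⟩ := hu.exists_right_inv
  refine ⟨ψ, fun x => ?_⟩
  have : φ x * ψ x = 1 := congrFun (congrArg Subtype.val hψ) x
  rw [eq_div_iff (hφ0 x), mul_comm, this]

/-- Evaluation at a point as a linear functional on the multiplier algebra. -/
def evalLin (x : X) : Mult H →ₗ[ℂ] ℂ where
  toFun φ := φ x
  map_add' _ _ := rfl
  map_smul' _ _ := rfl

/-- Evaluation at a point as a character of the multiplier algebra. -/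
noncomputable def evalCharacter (hker : ∀ x : X, ∃ f : H, f x ≠ 0) (x : X) :
    MaximalIdealSpace H :=
  ⟨(⟨evalLin x, AddMonoidHomClass.continuous_of_bound (evalLin x) 1 fun φ => by
      rw [one_mul]; exact norm_apply_le hker φ x⟩ : Mult H →L[ℂ] ℂ),
    fun h => one_ne_zero (α := ℂ)
      (congrArg (fun T : Mult H →L[ℂ] ℂ => T (1 : Mult H)) h), fun _ _ => rfl⟩

theorem evalCharacter_apply (hker : ∀ x : X, ∃ f : H, f x ≠ 0) (x : X) (φ : Mult H) :
    evalCharacter hker x φ = φ x := rfl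

end Mult

namespace WeightedHardy

variable {w : SummableWeight}

theorem exists_apply_ne_zero (z : ClosedDisc) : ∃ f : WeightedHardy w, f z ≠ 0 :=
  ⟨monomial 0, by simp [monomial_apply]⟩

theorem exists_eq_mult (φ : Mult (WeightedHardy w)) : ∃ f : WeightedHardy w, ∀ z, f z = φ z :=
  ⟨φ.mulFun (monomial 0), fun z => by simp [Mult.mulFun_apply, monomial_apply]⟩

/-- The disc is compact and the character space Hausdorff, so continuity and injectivity suffice;
the multiplier `z` separates points. -/
theorem isEmbedding_evalCharacter (φ : Mult (WeightedHardy w)) (hφ : ∀ z : ClosedDisc, φ z = z) :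
    Topology.IsEmbedding
      (Mult.evalCharacter (H := WeightedHardy w) exists_apply_ne_zero) := by
  have hcont : Continuous (Mult.evalCharacter (H := WeightedHardy w) exists_apply_ne_zero) := by
    refine Continuous.subtype_mk (WeakDual.continuous_of_continuous_eval fun ψ => ?_) _
    obtain ⟨f, hf⟩ := exists_eq_mult ψ
    exact (continuous_apply f).congr hf
  refine (hcont.isClosedEmbedding fun z t h => ?_).isEmbedding
  have := congrArg (fun χ : MaximalIdealSpace (WeightedHardy w) => χ φ) h
  simp only [Mult.evalCharacter_apply, hφ] at this
  exact Subtype.ext this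

end WeightedHardy

/-! ### Contractions with prescribed values and the state space. -/

/-- The norm inequality makes `x i ↦ y i` well defined and contractive on the span. It extends to
the closure, and precomposing with the orthogonal projection extends it by zero to the complement.
-/
theorem exists_contraction_of_norm_sum_le {ι E F : Type*} [NormedAddCommGroup E]
    [InnerProductSpace ℂ E] [CompleteSpace E] [NormedAddCommGroup F] [InnerProductSpace ℂ F]
    [CompleteSpace F] (x : ι → E) (y : ι → F)
    (h : ∀ (s : Finset ι) (c : ι → ℂ), ‖∑ i ∈ s, c i • y i‖ ≤ ‖∑ i ∈ s, c i • x i‖) :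
    ∃ V : E →L[ℂ] F, ‖V‖ ≤ 1 ∧ ∀ i, V (x i) = y i := by
  set Lx := Finsupp.linearCombination ℂ x with hLx
  set Ly := Finsupp.linearCombination ℂ y with hLy
  have hle : ∀ c, ‖Ly c‖ ≤ 1 * ‖Lx c‖ := fun c => by
    rw [one_mul, hLx, hLy, Finsupp.linearCombination_apply, Finsupp.linearCombination_apply]
    exact h c.support c
  let S := Lx.range.topologicalClosure
  have hmem : ∀ c, Lx c ∈ S := fun c =>
    Submodule.le_topologicalClosure _ (LinearMap.mem_range_self Lx c)
  let e : (ι →₀ ℂ) →ₗ[ℂ] S := Lx.codRestrict S hmem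
  have hdense : DenseRange e := by
    intro t
    rw [Metric.mem_closure_iff]
    intro ε hε
    obtain ⟨_, ⟨c, rfl⟩, hc⟩ := Metric.mem_closure_iff.1 (show (t : E) ∈ closure (Lx.range : Set E)
      from t.2) ε hε
    exact ⟨e c, ⟨c, rfl⟩, hc⟩
  have hle' : ∀ c, ‖Ly c‖ ≤ 1 * ‖e c‖ := hle
  have : CompleteSpace S := (Submodule.isClosed_topologicalClosure _).completeSpace_coe
  refine ⟨(Ly.extendOfNorm e).comp S.orthogonalProjectionOnto, ?_, fun i => ?_⟩
  · refine (ContinuousLinearMap.opNorm_comp_le _ _).trans ?_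
    exact mul_le_one₀ (LinearMap.opNorm_extendOfNorm_le hdense zero_le_one hle') (norm_nonneg _)
      (Submodule.orthogonalProjectionOnto_norm_le S)
  · have h1 : Lx (Finsupp.single i 1) = x i := by simp [hLx]
    have h2 : Ly (Finsupp.single i 1) = y i := by simp [hLy]
    have h3 : S.orthogonalProjectionOnto (x i) = e (Finsupp.single i 1) := by
      have := Submodule.orthogonalProjectionOnto_mem_subspace_eq_self (K := S) (e (Finsupp.single i 1))
      rw [← this]
      exact congrArg _ h1.symm
    rw [ContinuousLinearMap.comp_apply, h3, LinearMap.extendOfNorm_eq hdense ⟨1, hle'⟩, h2]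

theorem norm_sum_le_of_inner_eq {ι E F : Type*} [NormedAddCommGroup E]
    [InnerProductSpace ℂ E] [NormedAddCommGroup F] [InnerProductSpace ℂ F] (x : ι → E) (y : ι → F)
    (h : ∀ i j, inner ℂ (x i) (x j) = inner ℂ (y i) (y j)) (s : Finset ι) (c : ι → ℂ) :
    ‖∑ i ∈ s, c i • y i‖ ≤ ‖∑ i ∈ s, c i • x i‖ := by
  refine (sq_le_sq₀ (norm_nonneg _) (norm_nonneg _)).1 (le_of_eq ?_)
  rw [← inner_self_eq_norm_sq (𝕜 := ℂ), ← inner_self_eq_norm_sq (𝕜 := ℂ)]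
  simp_rw [sum_inner, inner_sum, inner_smul_left, inner_smul_right, h]

section ShiftedCopies

variable {K : Type*} [NormedAddCommGroup K] [InnerProductSpace ℂ K] {b : ℕ → ℝ}

theorem memℓp_shiftedCopies (hb : ∀ n, 0 ≤ b n) (hs : Summable b) (z : ClosedDisc) (l : K) :
    Memℓp (fun n => ((√(b n) : ℂ) * star (z : ℂ) ^ n) • l) 2 := by
  rw [memℓp_gen_iff (by norm_num)]
  refine .of_nonneg_of_le (fun n => by positivity) (fun n => ?_) (hs.mul_right (‖l‖ ^ 2))
  have h := z.norm_pow_le_one n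
  rw [norm_smul, norm_mul, norm_pow, norm_star, ← norm_pow, Complex.norm_real, Real.norm_eq_abs,
    abs_of_nonneg (Real.sqrt_nonneg _)]
  simp only [ENNReal.toReal_ofNat, Real.rpow_ofNat]
  rw [mul_pow, mul_pow, Real.sq_sqrt (hb n)]
  have : ‖(z : ℂ) ^ n‖ ^ 2 ≤ 1 := pow_le_one₀ (norm_nonneg _) h
  have := mul_le_of_le_one_right (hb n) this
  gcongr

/-- The map `l ↦ (√(b n) * conj z ^ n * l)_n`. -/
noncomputable def shiftedCopies (hb : ∀ n, 0 ≤ b n) (hs : Summable b) (z : ClosedDisc) :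
    K →ₗ[ℂ] lp (fun _ : ℕ => K) 2 where
  toFun l := ⟨_, memℓp_shiftedCopies hb hs z l⟩
  map_add' l m := by
    ext n
    exact smul_add _ l m
  map_smul' c l := by
    ext n
    exact smul_comm _ c l

variable (hb : ∀ n, 0 ≤ b n) (hs : Summable b)

theorem shiftedCopies_apply (z : ClosedDisc) (l : K) (n : ℕ) :
    shiftedCopies hb hs z l n = ((√(b n) : ℂ) * star (z : ℂ) ^ n) • l := rfl

theorem hasSum_norm_sum_shiftedCopies_sq {ι : Type*} (s : Finset ι) (c : ι → ℂ)
    (z : ι → ClosedDisc) (l : ι → K) :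
    HasSum (fun n => b n * ‖∑ i ∈ s, (c i * star (z i : ℂ) ^ n) • l i‖ ^ 2)
      (‖∑ i ∈ s, c i • shiftedCopies hb hs (z i) (l i)‖ ^ 2) := by
  have h := lp.hasSum_norm (p := 2) (by norm_num)
    (∑ i ∈ s, c i • shiftedCopies hb hs (z i) (l i))
  simp only [ENNReal.toReal_ofNat, Real.rpow_ofNat] at h
  convert! h using 2 with n
  have : (∑ i ∈ s, c i • shiftedCopies hb hs (z i) (l i)) n =
      (√(b n) : ℂ) • ∑ i ∈ s, (c i * star (z i : ℂ) ^ n) • l i := by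
    rw [lp.coeFn_sum, Finset.sum_apply, Finset.smul_sum]
    refine Finset.sum_congr rfl fun i _ => ?_
    rw [lp.coeFn_smul, Pi.smul_apply, shiftedCopies_apply, smul_smul, smul_smul]
    ring_nf
  rw [this, norm_smul, mul_pow, Complex.norm_real, Real.norm_eq_abs, sq_abs,
    Real.sq_sqrt (hb n)]

theorem norm_shiftedCopies_le (z : ClosedDisc) (l : K) :
    ‖shiftedCopies hb hs z l‖ ≤ √(∑' n, b n) * ‖l‖ := by
  refine (sq_le_sq₀ (norm_nonneg _) (by positivity)).1 ?_
  rw [mul_pow, Real.sq_sqrt (tsum_nonneg hb), ← tsum_mul_right]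
  have h := hasSum_norm_sum_shiftedCopies_sq hb hs {()} (fun _ => 1) (fun _ => z) (fun _ => l)
  simp only [Finset.sum_singleton, one_smul, one_mul] at h
  refine hasSum_le (fun n => ?_) h (hs.mul_right _).hasSum
  rw [norm_smul, mul_pow]
  have h1 : ‖star (z : ℂ) ^ n‖ ^ 2 ≤ 1 := by
    rw [norm_pow, norm_star, ← norm_pow]
    exact pow_le_one₀ (norm_nonneg _) (z.norm_pow_le_one n)
  exact mul_le_mul_of_nonneg_left (mul_le_of_le_one_left (sq_nonneg _) h1) (hb n)

theorem inner_shiftedCopies (z t : ClosedDisc) (l m : K) :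
    HasSum (fun n => (b n : ℂ) * ((z : ℂ) * star (t : ℂ)) ^ n * inner ℂ l m)
      (inner ℂ (shiftedCopies hb hs z l) (shiftedCopies hb hs t m)) := by
  convert! lp.hasSum_inner (𝕜 := ℂ) (shiftedCopies hb hs z l) (shiftedCopies hb hs t m) using 2
    with n
  have h : (√(b n) : ℂ) * √(b n) = b n := by
    exact_mod_cast Real.mul_self_sqrt (hb n)
  rw [shiftedCopies_apply, shiftedCopies_apply, inner_smul_left, inner_smul_right, ← h]
  simp only [map_mul, map_pow, Complex.conj_ofReal, ← Complex.star_def, star_star]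
  ring

/-- The equation is `(1 - A) l = const` with `‖A‖ ≤ √(∑ b n) < 1`, hence solved by a Neumann series.
Strictness keeps this valid on the boundary circle too. -/
theorem existsUnique_fixedPoint_of_contraction [CompleteSpace K] {F : Type*} [NormedAddCommGroup F]
    [InnerProductSpace ℂ F] (hb1 : ∑' n, b n < 1)
    (V : WithLp 2 (lp (fun _ : ℕ => K) 2 × F) →L[ℂ] WithLp 2 (K × F)) (hV : ‖V‖ ≤ 1)
    (z : ClosedDisc) (v : F) :
    ∃! l : K, (V (WithLp.toLp 2 (shiftedCopies hb hs z l, v))).fst = l := by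
  have hsq : √(∑' n, b n) < 1 := by
    rw [Real.sqrt_lt' one_pos]; simpa using hb1
  have hfst : ∀ t : WithLp 2 (lp (fun _ : ℕ => K) 2 × F), ‖(V t).fst‖ ≤ ‖t‖ := fun t =>
    (WithLp.norm_fst_le _ _).trans ((V.le_opNorm t).trans (mul_le_of_le_one_left (norm_nonneg _) hV))
  let A₀ : K →ₗ[ℂ] K :=
    { toFun := fun l => (V (WithLp.toLp 2 (shiftedCopies hb hs z l, 0))).fst
      map_add' := fun l m => by
        rw [← WithLp.add_fst, ← map_add, ← WithLp.toLp_add, Prod.mk_add_mk, add_zero, map_add]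
      map_smul' := fun c l => by
        rw [RingHom.id_apply, ← WithLp.smul_fst, ← map_smul, ← WithLp.toLp_smul, Prod.smul_mk,
          smul_zero, map_smul] }
  have hA₀ : ∀ l, ‖A₀ l‖ ≤ √(∑' n, b n) * ‖l‖ := fun l => by
    refine (hfst _).trans ?_
    rw [WithLp.norm_toLp_fst]
    exact norm_shiftedCopies_le hb hs z l
  let A : K →L[ℂ] K := A₀.mkContinuous _ hA₀
  have hA : ‖A‖ < 1 := (LinearMap.mkContinuous_norm_le _ (Real.sqrt_nonneg _) _).trans_lt hsq
  have hbij := ContinuousLinearMap.isUnit_iff_bijective.1 (isUnit_one_sub_of_norm_lt_one hA)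
  have hiff : ∀ l, (V (WithLp.toLp 2 (shiftedCopies hb hs z l, v))).fst = l ↔
      (1 - A) l = (V (WithLp.toLp 2 (0, v))).fst := fun l => by
    have h1 : (V (WithLp.toLp 2 (shiftedCopies hb hs z l, v))).fst =
        A l + (V (WithLp.toLp 2 (0, v))).fst := by
      change _ = (V (WithLp.toLp 2 (shiftedCopies hb hs z l, 0))).fst + _
      rw [← WithLp.add_fst, ← map_add, ← WithLp.toLp_add, Prod.mk_add_mk, add_zero, zero_add]
    rw [h1, _root_.sub_apply, one_apply_eq_self, sub_eq_iff_eq_add', eq_comm]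
  simp_rw [hiff]
  exact hbij.existsUnique _

end ShiftedCopies

/-! ### Renewal identities. -/

-- Grouping the double sum by `N = m + n`, the convolution `b * a` collapses to `a N`, except at `N
-- = 0`, where it vanishes; this produces the term `- t 0`.
open Finset in
theorem tsum_mul_tsum_shift_eq {a b t : ℕ → ℝ} {C : ℝ} (ha : ∀ n, 0 ≤ a n) (hb : ∀ n, 0 ≤ b n)
    (ht : ∀ n, 0 ≤ t n) (htC : ∀ n, t n ≤ C) (has : Summable a) (hbs : Summable b) (h0 : a 0 = 1)
    (hb0 : b 0 = 0) (hab : ∀ k, a (k + 1) = ∑ p ∈ antidiagonal (k + 1), b p.1 * a p.2) :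
    HasSum (fun m => a m * ∑' n, b n * t (m + n)) (∑' n, a n * t n - t 0) := by
  have hat : Summable fun n => a n * t n :=
    .of_nonneg_of_le (fun n => mul_nonneg (ha n) (ht n))
      (fun n => mul_le_mul_of_nonneg_left (htC n) (ha n)) (has.mul_right C)
  let F : ℕ × ℕ → ℝ := fun p => a p.1 * (b p.2 * t (p.1 + p.2))
  have hF : Summable F := by
    refine .of_nonneg_of_le (fun p => mul_nonneg (ha _) (mul_nonneg (hb _) (ht _))) (fun p => ?_)
      ((has.mul_of_nonneg hbs ha hb).mul_right C)
    calc F p ≤ a p.1 * (b p.2 * C) :=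
          mul_le_mul_of_nonneg_left (mul_le_mul_of_nonneg_left (htC _) (hb _)) (ha _)
      _ = _ := by ring
  have h1 : HasSum (fun m => a m * ∑' n, b n * t (m + n)) (∑' p, F p) := by
    have := hF.hasSum.prod_fiberwise fun m => (hF.prod_factor m).hasSum
    simpa only [F, tsum_mul_left] using this
  have h2 : HasSum (fun N => ∑ p ∈ antidiagonal N, F p) (∑' p, F p) := by
    have hG : HasSum (F ∘ HasAntidiagonal.sigmaAntidiagonalEquivProd) (∑' p, F p) :=
      HasAntidiagonal.sigmaAntidiagonalEquivProd.hasSum_iff.2 hF.hasSum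
    have := hG.sigma fun N => hasSum_fintype _
    convert! this using 2 with N
    exact (sum_coe_sort (antidiagonal N) F).symm
  have h3 : ∀ N, ∑ p ∈ antidiagonal N, F p = a N * t N - if N = 0 then t 0 else 0 := fun N => by
    have : ∑ p ∈ antidiagonal N, F p = (∑ p ∈ antidiagonal N, b p.1 * a p.2) * t N := by
      rw [← Nat.sum_antidiagonal_swap, sum_mul]
      refine sum_congr rfl fun p hp => ?_
      rw [HasAntidiagonal.mem_antidiagonal] at hp
      simp only [F, Prod.fst_swap, Prod.snd_swap]
      rw [add_comm, hp]
      ring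
    rw [this]
    cases N with
    | zero => simp [hb0, h0]
    | succ k => rw [← hab]; simp
  have h4 : HasSum (fun N => ∑ p ∈ antidiagonal N, F p) (∑' n, a n * t n - t 0) := by
    simp_rw [h3]
    exact hat.hasSum.sub (hasSum_ite_eq 0 (t 0))
  exact h2.unique h4 ▸ h1

open Finset in
theorem renewal_le {a b : ℕ → ℝ} (ha : ∀ n, 0 ≤ a n) (hb : ∀ n, 0 ≤ b n) (h0 : a 0 = 1)
    (hb0 : b 0 = 0)
    (hab : ∀ k, a (k + 1) = ∑ p ∈ antidiagonal (k + 1), b p.1 * a p.2) (n : ℕ) :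
    b n ≤ a n := by
  cases n with
  | zero => rw [hb0, h0]; exact zero_le_one
  | succ k =>
    rw [hab]
    have := single_le_sum (f := fun p : ℕ × ℕ => b p.1 * a p.2)
      (fun p _ => mul_nonneg (hb p.1) (ha p.2))
      (show (k + 1, 0) ∈ antidiagonal (k + 1) by simp)
    simpa [h0] using this

-- Taking `t = 1` in the shifted sum identity gives `(∑ a) * (∑ b) = ∑ a - 1`.
open Finset in
theorem tsum_renewal_lt_one {a b : ℕ → ℝ} (ha : ∀ n, 0 < a n) (hb : ∀ n, 0 ≤ b n)
    (has : Summable a) (hbs : Summable b) (h0 : a 0 = 1)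
    (hb0 : b 0 = 0)
    (hab : ∀ k, a (k + 1) = ∑ p ∈ antidiagonal (k + 1), b p.1 * a p.2) :
    ∑' n, b n < 1 := by
  have h := tsum_mul_tsum_shift_eq (t := fun _ => 1) (C := 1) (fun n => (ha n).le) hb
    (fun _ => zero_le_one) (fun _ => le_rfl) has hbs h0 hb0 hab
  simp only [mul_one] at h
  have h1 := h.tsum_eq
  rw [tsum_mul_right] at h1
  have h2 : 0 < ∑' n, a n := has.tsum_pos (fun n => (ha n).le) 0 (ha 0)
  nlinarith

open Finset in
theorem tsum_mul_one_sub_renewal {a b : ℕ → ℝ} (ha : ∀ n, 0 < a n) (hb : ∀ n, 0 ≤ b n)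
    (has : Summable a) (hbs : Summable b) (h0 : a 0 = 1) (hb0 : b 0 = 0)
    (hab : ∀ k, a (k + 1) = ∑ p ∈ antidiagonal (k + 1), b p.1 * a p.2) (q : ClosedDisc) :
    (1 - ∑' n, (b n : ℂ) * (q : ℂ) ^ n) * ∑' n, (a n : ℂ) * (q : ℂ) ^ n = 1 := by
  have hna : Summable fun n => ‖(a n : ℂ) * (q : ℂ) ^ n‖ :=
    q.summable_mul_pow (by simpa [abs_of_pos (ha _)] using has)
  have hnb : Summable fun n => ‖(b n : ℂ) * (q : ℂ) ^ n‖ :=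
    q.summable_mul_pow (by simpa [abs_of_nonneg (hb _)] using hbs)
  rw [sub_mul, one_mul, tsum_mul_tsum_eq_tsum_sum_antidiagonal_of_summable_norm hnb hna]
  have h1 : ∀ N, ∑ p ∈ antidiagonal N, (b p.1 : ℂ) * (q : ℂ) ^ p.1 * ((a p.2 : ℂ) * (q : ℂ) ^ p.2)
      = (a N : ℂ) * (q : ℂ) ^ N - if N = 0 then 1 else 0 := fun N => by
    have : ∑ p ∈ antidiagonal N, (b p.1 : ℂ) * (q : ℂ) ^ p.1 * ((a p.2 : ℂ) * (q : ℂ) ^ p.2) =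
        (∑ p ∈ antidiagonal N, b p.1 * a p.2 : ℝ) * (q : ℂ) ^ N := by
      push_cast
      rw [sum_mul]
      refine sum_congr rfl fun p hp => ?_
      rw [← mem_antidiagonal.1 hp, pow_add]
      ring
    rw [this]
    cases N with
    | zero => simp [hb0, h0]
    | succ k => rw [← hab]; simp
  simp_rw [h1]
  rw [(hna.of_norm.hasSum.sub (hasSum_ite_eq 0 (1 : ℂ))).tsum_eq]
  ring

/-! ### Matrix multipliers and the complete Pick property. -/

namespace WeightedHardy

variable {w : SummableWeight} {r : ℕ}

/-- The coordinate functionals with respect to the orthonormal basis `√(a n) z ^ n`. -/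
def coord (n : ℕ) : WeightedHardy w →ₗ[ℂ] ℂ where
  toFun f := f.1 n
  map_add' _ _ := rfl
  map_smul' _ _ := rfl

/-- The vector `k_z ⊗ v` in the direct sum of `r` copies of the space. -/
noncomputable def vectorKernel (z : ClosedDisc) (v : EuclideanSpace ℂ (Fin r)) :
    PiLp 2 (fun _ : Fin r => WeightedHardy w) :=
  WithLp.toLp 2 fun p => v p • kernelVec z

theorem vectorKernel_apply (z : ClosedDisc) (v : EuclideanSpace ℂ (Fin r)) (p : Fin r) :
    (vectorKernel z v : PiLp 2 (fun _ : Fin r => WeightedHardy w)) p = v p • kernelVec z := rfl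

theorem hasSum_norm_sum_vectorKernel_sq {ι : Type*} (s : Finset ι) (c : ι → ℂ)
    (z : ι → ClosedDisc) (v : ι → EuclideanSpace ℂ (Fin r)) :
    HasSum (fun n => w.a n * ‖∑ i ∈ s, (c i * star (z i : ℂ) ^ n) • v i‖ ^ 2)
      (‖∑ i ∈ s, c i • (vectorKernel (z i) (v i) :
        PiLp 2 (fun _ : Fin r => WeightedHardy w))‖ ^ 2) := by
  set f : PiLp 2 (fun _ : Fin r => WeightedHardy w) := ∑ i ∈ s, c i • vectorKernel (z i) (v i)
    with hf
  have hfp : ∀ p, f p = ∑ i ∈ s, (c i * v i p) • kernelVec (z i) := fun p => by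
    rw [hf, WithLp.ofLp_sum, Finset.sum_apply]
    refine Finset.sum_congr rfl fun i _ => ?_
    rw [PiLp.smul_apply, vectorKernel_apply, smul_smul]
  have hn : ∀ p n, ‖(f p).1 n‖ ^ 2 =
      w.a n * ‖(∑ i ∈ s, (c i * star (z i : ℂ) ^ n) • v i) p‖ ^ 2 := fun p n => by
    have : (f p).1 n = (√(w.a n) : ℂ) * (∑ i ∈ s, (c i * star (z i : ℂ) ^ n) • v i) p := by
      rw [hfp]
      change coord n _ = _
      rw [map_sum, WithLp.ofLp_sum, Finset.sum_apply, Finset.mul_sum]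
      refine Finset.sum_congr rfl fun i _ => ?_
      rw [map_smul, PiLp.smul_apply, smul_eq_mul, smul_eq_mul]
      change _ * (kernelVec (z i) : WeightedHardy w).1 n = _
      rw [kernelVec_val]
      ring
    rw [this, norm_mul, mul_pow, Complex.norm_real, Real.norm_eq_abs, sq_abs,
      Real.sq_sqrt (w.a_pos n).le]
  rw [PiLp.norm_sq_eq_of_L2]
  simp_rw [EuclideanSpace.norm_sq_eq, Finset.mul_sum, ← hn]
  refine hasSum_sum fun p _ => ?_
  simpa only [norm_coeff_sq] using hasSum_norm_coeff_sq (f p)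

/-- The hypothesis says that `k_z ⊗ e_p ↦ k_z ⊗ Φ(z)* e_p` extends to a contraction; its adjoint is
multiplication by `Φ`. -/
theorem exists_matrix_mult_of_contraction (Φ : ClosedDisc → Matrix (Fin r) (Fin r) ℂ)
    (h : ∀ (s : Finset (ClosedDisc × Fin r)) (c : ClosedDisc × Fin r → ℂ),
      ‖∑ i ∈ s, c i • (vectorKernel i.1 (WithLp.toLp 2 fun q => star (Φ i.1 i.2 q)) :
        PiLp 2 (fun _ : Fin r => WeightedHardy w))‖ ≤
      ‖∑ i ∈ s, c i • (vectorKernel i.1 (EuclideanSpace.single i.2 1) :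
        PiLp 2 (fun _ : Fin r => WeightedHardy w))‖) :
    ∃ Ψ : Matrix (Fin r) (Fin r) (Mult (WeightedHardy w)),
      ‖Mult.matrixOp Ψ‖ ≤ 1 ∧ ∀ z p q, (Ψ p q) z = Φ z p q := by
  obtain ⟨V, hV, hVx⟩ := exists_contraction_of_norm_sum_le _ _ h
  set T := V.adjoint with hT
  have hTf : ∀ f p z, T f p z = ∑ q, Φ z p q * f q z := fun f p z => by
    have h1 : inner ℂ (vectorKernel z (EuclideanSpace.single p 1)) (T f) =
        inner ℂ (kernelVec z) (T f p) := by
      rw [PiLp.inner_apply, Finset.sum_eq_single p]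
      · simp [vectorKernel_apply]
      · intro q _ hq
        simp [vectorKernel_apply, hq]
      · simp
    rw [apply_eq_inner, ← h1, hT, ContinuousLinearMap.adjoint_inner_right, hVx (z, p),
      PiLp.inner_apply]
    refine Finset.sum_congr rfl fun q _ => ?_
    rw [vectorKernel_apply, inner_smul_left, ← apply_eq_inner]
    simp
  have hmem : ∀ p q, (fun z => Φ z p q) ∈ multiplierSubalgebra (WeightedHardy w) := fun p q f => by
    refine ⟨T (WithLp.toLp 2 (Pi.single q f)) p, fun z => ?_⟩
    rw [hTf, Finset.sum_eq_single q]
    · simp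
    · intro q' _ hq
      simp [hq]
    · simp
  let Ψ : Matrix (Fin r) (Fin r) (Mult (WeightedHardy w)) := fun p q => ⟨_, hmem p q⟩
  refine ⟨Ψ, ?_, fun z p q => rfl⟩
  have : Mult.matrixOp Ψ = T := by
    refine ContinuousLinearMap.ext fun f => PiLp.ext fun p => RKHS.ext fun z => ?_
    have hsum : ∀ F : Fin r → WeightedHardy w, (∑ q, F q) z = ∑ q, F q z := fun F => by
      simp_rw [apply_eq_inner, inner_sum]
    rw [hTf, Mult.matrixOp_apply, hsum]
    exact Finset.sum_congr rfl fun q _ => Mult.mulOp_apply _ _ _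
  rw [this, hT, LinearIsometryEquiv.norm_map]
  exact hV

end WeightedHardy

theorem WithLp.sum_fst {ι α β : Type*} [NormedAddCommGroup α] [NormedAddCommGroup β]
    (s : Finset ι) (x : ι → WithLp 2 (α × β)) : (∑ i ∈ s, x i).fst = ∑ i ∈ s, (x i).fst :=
  map_sum (⟨⟨WithLp.fst, rfl⟩, fun _ _ => rfl⟩ : WithLp 2 (α × β) →+ α) x s

theorem WithLp.sum_snd {ι α β : Type*} [NormedAddCommGroup α] [NormedAddCommGroup β]
    (s : Finset ι) (x : ι → WithLp 2 (α × β)) : (∑ i ∈ s, x i).snd = ∑ i ∈ s, (x i).snd :=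
  map_sum (⟨⟨WithLp.snd, rfl⟩, fun _ _ => rfl⟩ : WithLp 2 (α × β) →+ β) x s

/-- The product of `z` and `conj t`, as a point of the disc. -/
noncomputable def ClosedDisc.mulStar (z t : ClosedDisc) : ClosedDisc :=
  ⟨(z : ℂ) * star (t : ℂ), mem_closedBall_zero_iff.2 (by
    rw [norm_mul, norm_star]
    exact mul_le_one₀ z.norm_le_one (norm_nonneg _) t.norm_le_one)⟩

namespace WeightedHardy

variable {w : SummableWeight}

open Finset in
theorem isCompletePick_of_renewal {b : ℕ → ℝ} (hb : ∀ n, 0 ≤ b n) (hb0 : b 0 = 0)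
    (hab : ∀ k, w.a (k + 1) = ∑ p ∈ antidiagonal (k + 1), b p.1 * w.a p.2) :
    IsCompletePick (WeightedHardy w) := by
  intro r n z W hP
  have ha : ∀ n, 0 ≤ w.a n := fun n => (w.a_pos n).le
  have hbs : Summable b := .of_nonneg_of_le hb (renewal_le ha hb w.a_zero hb0 hab) w.a_summable
  have hb1 := tsum_renewal_lt_one w.a_pos hb w.a_summable hbs w.a_zero hb0 hab
  -- A Gram factorisation of the Pick matrix; its vectors `l s` live in the state space `K`.
  obtain ⟨d, L, hL⟩ := Matrix.posSemidef_iff_eq_sum_vecMulVec.1 hP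
  let K := EuclideanSpace ℂ (Fin d)
  let l : Fin n × Fin r → K := fun s => WithLp.toLp 2 fun u => star (L u s)
  have hl : ∀ s t, inner ℂ (l s) (l t) = scalarKernel (WeightedHardy w) (z s.1) (z t.1) *
        ((1 : Matrix (Fin r) (Fin r) ℂ) - W s.1 * (W t.1).conjTranspose) s.2 t.2 := fun s t => by
    have := congrFun (congrFun hL s) t
    rw [Matrix.of_apply] at this
    rw [this, Matrix.sum_apply, PiLp.inner_apply]
    refine sum_congr rfl fun u _ => ?_
    simp [l, Matrix.vecMulVec_apply, mul_comm]
  let E := WithLp 2 (lp (fun _ : ℕ => K) 2 × EuclideanSpace ℂ (Fin r))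
  let F := WithLp 2 (K × EuclideanSpace ℂ (Fin r))
  let x : Fin n × Fin r → E := fun s =>
    WithLp.toLp 2 (shiftedCopies hb hbs (z s.1) (l s), EuclideanSpace.single s.2 1)
  let y : Fin n × Fin r → F := fun s =>
    WithLp.toLp 2 (l s, WithLp.toLp 2 fun q => star (W s.1 s.2 q))
  -- The lurking isometry: multiplying the Gram identity by the reciprocal kernel `1 - ∑ b n q ^ n`
  -- and separating signs gives equal inner products.
  have hxy : ∀ s t, inner ℂ (x s) (x t) = inner ℂ (y s) (y t) := fun s t => by
    have h1 : inner ℂ (x s) (x t) = (∑' n, (b n : ℂ) * ((z s.1).mulStar (z t.1) : ℂ) ^ n) *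
        inner ℂ (l s) (l t) + (1 : Matrix (Fin r) (Fin r) ℂ) s.2 t.2 := by
      rw [WithLp.prod_inner_apply, ← tsum_mul_right]
      congr 1
      · exact (inner_shiftedCopies hb hbs (z s.1) (z t.1) (l s) (l t)).tsum_eq.symm
      · simp [x, EuclideanSpace.inner_single_left, Matrix.one_apply]
    have h2 : inner ℂ (y s) (y t) = inner ℂ (l s) (l t) +
        (W s.1 * (W t.1).conjTranspose) s.2 t.2 := by
      rw [WithLp.prod_inner_apply, Matrix.mul_apply]
      congr 1
      rw [PiLp.inner_apply]
      refine sum_congr rfl fun q _ => ?_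
      simp [y, mul_comm]
    have h3 := tsum_mul_one_sub_renewal w.a_pos hb w.a_summable hbs w.a_zero hb0 hab
      ((z s.1).mulStar (z t.1))
    have h4 : ∑' n, (w.a n : ℂ) * ((z s.1).mulStar (z t.1) : ℂ) ^ n =
      scalarKernel (WeightedHardy w) (z s.1) (z t.1) := (hasSum_scalarKernel _ _).tsum_eq
    rw [h4] at h3
    rw [h1, h2, hl, Matrix.sub_apply]
    linear_combination (-(1 : Matrix (Fin r) (Fin r) ℂ) s.2 t.2 +
      (W s.1 * (W t.1).conjTranspose) s.2 t.2) * h3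
  obtain ⟨V, hV, hVx⟩ := exists_contraction_of_norm_sum_le x y (norm_sum_le_of_inner_eq x y hxy)
  -- The state at an arbitrary point `t` solves the same equation that `l s` solves at the nodes.
  -- Uniqueness then forces `m` to equal `l` at the nodes, hence the interpolation.
  choose m hm hmu using fun (t : ClosedDisc) (p : Fin r) =>
    existsUnique_fixedPoint_of_contraction hb hbs hb1 V hV t (EuclideanSpace.single p 1)
  let X : ClosedDisc × Fin r → E := fun s =>
    WithLp.toLp 2 (shiftedCopies hb hbs s.1 (m s.1 s.2), EuclideanSpace.single s.2 1)
  let v : ClosedDisc × Fin r → EuclideanSpace ℂ (Fin r) := fun s => (V (X s)).snd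
  have hVX : ∀ s, V (X s) = WithLp.toLp 2 (m s.1 s.2, v s) := fun s => by
    have := hm s.1 s.2
    exact WithLp.ofLp_injective 2 (Prod.ext this rfl)
  have hdata : ∀ s : Fin n × Fin r, v (z s.1, s.2) = WithLp.toLp 2 fun q => star (W s.1 s.2 q) :=
    fun s => by
      have h1 : m (z s.1) s.2 = l s := by
        refine (hmu (z s.1) s.2 (l s) ?_).symm
        change (V (x s)).fst = l s
        rw [hVx]
        rfl
      have h2 : X (z s.1, s.2) = x s := by simp only [X, x, h1]
      change (V (X (z s.1, s.2))).snd = _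
      rw [h2, hVx]
      rfl
  have hmain : ∀ (s : Finset (ClosedDisc × Fin r)) (c : ClosedDisc × Fin r → ℂ),
      ‖∑ i ∈ s, c i • m i.1 i.2‖ ^ 2 + ‖∑ i ∈ s, c i • v i‖ ^ 2 ≤
      ∑' n, b n * ‖∑ i ∈ s, (c i * star (i.1 : ℂ) ^ n) • m i.1 i.2‖ ^ 2 +
        ‖∑ i ∈ s, c i • (EuclideanSpace.single i.2 1 : EuclideanSpace ℂ (Fin r))‖ ^ 2 := by
    intro s c
    have h1 : ‖V (∑ i ∈ s, c i • X i)‖ ^ 2 ≤ ‖∑ i ∈ s, c i • X i‖ ^ 2 :=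
      pow_le_pow_left₀ (norm_nonneg _)
        ((V.le_opNorm _).trans (mul_le_of_le_one_left (norm_nonneg _) hV)) 2
    rw [WithLp.prod_norm_sq_eq_of_L2, WithLp.prod_norm_sq_eq_of_L2, map_sum] at h1
    have h2 : (∑ i ∈ s, V (c i • X i)).fst = ∑ i ∈ s, c i • m i.1 i.2 := by
      rw [WithLp.sum_fst]
      refine sum_congr rfl fun i _ => ?_
      rw [map_smul, hVX]
      rfl
    have h3 : (∑ i ∈ s, V (c i • X i)).snd = ∑ i ∈ s, c i • v i := by
      rw [WithLp.sum_snd]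
      refine sum_congr rfl fun i _ => ?_
      rw [map_smul]
      rfl
    have h4 : (∑ i ∈ s, c i • X i).fst = ∑ i ∈ s, c i • shiftedCopies hb hbs i.1 (m i.1 i.2) := by
      rw [WithLp.sum_fst]
      rfl
    have h5 : (∑ i ∈ s, c i • X i).snd =
        ∑ i ∈ s, c i • (EuclideanSpace.single i.2 1 : EuclideanSpace ℂ (Fin r)) := by
      rw [WithLp.sum_snd]
      rfl
    rw [h2, h3, h4, h5] at h1
    rwa [(hasSum_norm_sum_shiftedCopies_sq hb hbs s c (fun i => i.1) fun i => m i.1 i.2).tsum_eq]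
  obtain ⟨Ψ, hΨ, hΨv⟩ := exists_matrix_mult_of_contraction (w := w)
    (fun t p q => star (v (t, p) q)) (fun s c => by
      simp only [star_star]
      change ‖∑ i ∈ s, c i • (vectorKernel i.1 (v i) :
        PiLp 2 (fun _ : Fin r => WeightedHardy w))‖ ≤ _
      refine (sq_le_sq₀ (norm_nonneg _) (norm_nonneg _)).1 ?_
      have hs1 := hasSum_norm_sum_vectorKernel_sq (w := w) s c (fun i => i.1) v
      have hs2 := hasSum_norm_sum_vectorKernel_sq (w := w) s c (fun i => i.1)
        (fun i => EuclideanSpace.single i.2 1)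
      let t : ℕ → ℝ := fun n => ‖∑ i ∈ s, (c i * star (i.1 : ℂ) ^ n) • m i.1 i.2‖ ^ 2
      have htC : ∀ n, t n ≤ (∑ i ∈ s, ‖c i‖ * ‖m i.1 i.2‖) ^ 2 := fun n => by
        refine pow_le_pow_left₀ (norm_nonneg _) ((norm_sum_le _ _).trans
          (sum_le_sum fun i _ => ?_)) 2
        rw [norm_smul, norm_mul, norm_pow, norm_star, ← norm_pow]
        gcongr
        exact mul_le_of_le_one_right (norm_nonneg _) (i.1.norm_pow_le_one n)
      -- The inequality `hmain`, applied to the coefficients `c i * conj(z i) ^ k`, is weighted by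
      -- `a k` and summed over `k`. The renewal identity cancels the state terms up to `t 0 ≥ 0`,
      -- which has the favourable sign.
      have hs3 := tsum_mul_tsum_shift_eq ha hb (fun n => sq_nonneg _) htC w.a_summable hbs
        w.a_zero hb0 hab
      have hs4 : HasSum (fun n => w.a n * t n) (∑' n, w.a n * t n) :=
        (Summable.of_nonneg_of_le (fun n => mul_nonneg (ha n) (sq_nonneg _))
          (fun n => mul_le_mul_of_nonneg_left (htC n) (ha n)) (w.a_summable.mul_right _)).hasSum
      have hle := hasSum_le (fun k => ?_) (hs4.add hs1) (hs3.add hs2)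
      · have : 0 ≤ t 0 := sq_nonneg _
        linarith
      · rw [← mul_add, ← mul_add]
        refine mul_le_mul_of_nonneg_left ?_ (ha k)
        have := hmain s fun i => c i * star (i.1 : ℂ) ^ k
        simpa only [mul_assoc, ← pow_add] using this)
  refine ⟨Ψ, hΨ, fun i p q => ?_⟩
  rw [hΨv, hdata (i, p)]
  simp

end WeightedHardy

/-! ### Boundedness tests for lower triangular matrices. -/

open Finset in
theorem Summable.sum_antidiagonal {F : ℕ × ℕ → ℝ} (hF : Summable F) :
    Summable fun l => ∑ p ∈ antidiagonal l, F p := by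
  have h := (HasAntidiagonal.sigmaAntidiagonalEquivProd.summable_iff.2 hF).sigma
  refine h.congr fun l => ?_
  rw [tsum_fintype]
  exact sum_coe_sort (antidiagonal l) F

open Finset in
/-- The Schur test for lower triangular matrices. -/
theorem summable_sq_sum_of_schur {P : ℕ → ℕ → ℝ} {x : ℕ → ℝ} {R : ℝ} (hP : ∀ m k, 0 ≤ P m k)
    (hrow : ∀ l, ∑ p ∈ antidiagonal l, P p.1 p.2 ≤ R)
    (hcol : ∀ k M, ∑ m ∈ range M, P m k ≤ R) (hx : Summable fun k => x k ^ 2) :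
    Summable fun l => (∑ p ∈ antidiagonal l, P p.1 p.2 * x p.2) ^ 2 := by
  have hcs : ∀ k, Summable fun m => P m k := fun k =>
    summable_of_sum_range_le (fun m => hP m k) (hcol k)
  have hF : Summable fun p : ℕ × ℕ => P p.1 p.2 * x p.2 ^ 2 := by
    have h : Summable fun p : ℕ × ℕ => P p.2 p.1 * x p.1 ^ 2 := by
      rw [summable_prod_of_nonneg fun p => mul_nonneg (hP _ _) (sq_nonneg _)]
      refine ⟨fun k => show Summable fun m => P m k * x k ^ 2 from (hcs k).mul_right (x k ^ 2), ?_⟩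
      simp only [tsum_mul_right]
      refine .of_nonneg_of_le (fun k => mul_nonneg (tsum_nonneg fun m => hP m k) (sq_nonneg _))
        (fun k => ?_) (hx.mul_left R)
      exact mul_le_mul_of_nonneg_right
        (Real.tsum_le_of_sum_range_le (fun m => hP m k) (hcol k)) (sq_nonneg _)
    exact h.prod_symm
  refine .of_nonneg_of_le (fun l => sq_nonneg _) (fun l => ?_) (hF.sum_antidiagonal.mul_left R)
  calc (∑ p ∈ antidiagonal l, P p.1 p.2 * x p.2) ^ 2
      ≤ (∑ p ∈ antidiagonal l, P p.1 p.2) * ∑ p ∈ antidiagonal l, P p.1 p.2 * x p.2 ^ 2 :=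
        sum_sq_le_sum_mul_sum_of_sq_le_mul _ (fun p _ => hP _ _)
          (fun p _ => mul_nonneg (hP _ _) (sq_nonneg _)) fun p _ => le_of_eq (by ring)
    _ ≤ _ := mul_le_mul_of_nonneg_right (hrow l)
        (sum_nonneg fun p _ => mul_nonneg (hP _ _) (sq_nonneg _))

-- Cauchy–Schwarz on each row; the antidiagonal `m + k = l` is row `l` of the matrix.
open Finset in
theorem summable_sq_sum_of_hilbertSchmidt {Q : ℕ → ℕ → ℝ} {x : ℕ → ℝ}
    (hQ : Summable fun p : ℕ × ℕ => Q p.1 p.2 ^ 2) (hx : Summable fun k => x k ^ 2) :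
    Summable fun l => (∑ p ∈ antidiagonal l, Q p.1 p.2 * x p.2) ^ 2 := by
  refine .of_nonneg_of_le (fun l => sq_nonneg _) (fun l => ?_)
    (hQ.sum_antidiagonal.mul_right (∑' k, x k ^ 2))
  refine (sum_mul_sq_le_sq_mul_sq _ _ _).trans
    (mul_le_mul_of_nonneg_left ?_ (sum_nonneg fun p _ => sq_nonneg _))
  rw [← Nat.sum_antidiagonal_swap]
  simp only [Prod.snd_swap]
  rw [Nat.sum_antidiagonal_eq_sum_range_succ (fun i _ => x i ^ 2)]
  exact hx.sum_le_tsum _ fun k _ => sq_nonneg _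

theorem Finset.sum_le_of_forall_ne_zero_mem {ι : Type*} [DecidableEq ι] {S T : Finset ι}
    {D : ι → ℝ} {C : ℝ} (hC : 0 ≤ C) (h : ∀ i ∈ S, D i ≠ 0 → i ∈ T ∧ D i ≤ C / T.card) :
    ∑ i ∈ S, D i ≤ C := by
  calc ∑ i ∈ S, D i = ∑ i ∈ S.filter fun i => D i ≠ 0, D i := (Finset.sum_filter_ne_zero S).symm
    _ ≤ (S.filter fun i => D i ≠ 0).card • (C / T.card) :=
        Finset.sum_le_card_nsmul _ _ _ fun i hi => by
          rw [Finset.mem_filter] at hi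
          exact (h i hi.1 hi.2).2
    _ ≤ T.card * (C / T.card) := by
        rw [nsmul_eq_mul]
        refine mul_le_mul_of_nonneg_right ?_ (by positivity)
        exact_mod_cast Finset.card_le_card fun i hi => by
          rw [Finset.mem_filter] at hi
          exact (h i hi.1 hi.2).1
    _ ≤ C := by
        rcases eq_or_ne (T.card : ℝ) 0 with h0 | h0
        · rw [h0, zero_mul]; exact hC
        · rw [mul_div_cancel₀ _ h0]

/-! ### The test function and its matrix entries. -/

namespace BlockWeight

variable (B : BlockWeight)

/-- The underlying weight sequence. -/
def toSummableWeight : SummableWeight := ⟨B.a, B.a_zero, B.a_pos, B.a_summable⟩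

theorem n_mono : Monotone B.n :=
  monotone_nat_of_le_succ fun j => by have := B.n_step j; omega

theorem two_mul_n_le {i j : ℕ} (h : i < j) : 2 * B.n i ≤ B.n j :=
  (B.n_step i).trans (B.n_mono h)

theorem index_unique {i j m : ℕ} (hi : m ∈ Finset.Ico (B.n i) (2 * B.n i))
    (hj : m ∈ Finset.Ico (B.n j) (2 * B.n j)) : i = j := by
  rw [Finset.mem_Ico] at hi hj
  rcases lt_trichotomy i j with h | h | h
  · have := B.two_mul_n_le h; omega
  · exact h
  · have := B.two_mul_n_le h; omega

/-- The `j`-th window of the test function. -/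
noncomputable def window (j m : ℕ) : ℝ :=
  if m ∈ Finset.Ico (B.n j) (2 * B.n j) then B.ρ j ^ m / B.n j else 0

theorem window_nonneg (j m : ℕ) : 0 ≤ B.window j m := by
  rw [window]
  have := B.ρ_pos j
  split_ifs <;> positivity

theorem card_Ico_n (j : ℕ) : (Finset.Ico (B.n j) (2 * B.n j)).card = B.n j := by
  rw [Nat.card_Ico]; omega

theorem sum_window_le (j : ℕ) (S : Finset ℕ) : ∑ m ∈ S, B.window j m ≤ (1 / 4) ^ (j + 1) := by
  refine Finset.sum_le_of_forall_ne_zero_mem (T := Finset.Ico (B.n j) (2 * B.n j)) (by positivity)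
    fun m _ hm => ?_
  rw [window] at hm ⊢
  split_ifs at hm ⊢ with h
  · refine ⟨h, ?_⟩
    rw [card_Ico_n]
    have h1 : B.ρ j ^ m ≤ B.ρ j ^ B.n j :=
      pow_le_pow_of_le_one (B.ρ_pos j).le (B.ρ_lt_one j).le (Finset.mem_Ico.1 h).1
    exact div_le_div_of_nonneg_right (h1.trans (B.ρ_pow_n j)) (by positivity)
  · exact absurd rfl hm

theorem summable_window (j : ℕ) : Summable (B.window j) :=
  summable_of_sum_range_le (B.window_nonneg j) fun M => B.sum_window_le j (Finset.range M)

theorem tsum_window_le (j : ℕ) : ∑' m, B.window j m ≤ (1 / 4) ^ (j + 1) :=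
  Real.tsum_le_of_sum_range_le (B.window_nonneg j) fun M => B.sum_window_le j (Finset.range M)

theorem hasSum_quarter : HasSum (fun j : ℕ => (1 / 4 : ℝ) ^ (j + 1)) (1 / 3) := by
  have h := (hasSum_geometric_of_lt_one (r := (1 / 4 : ℝ)) (by norm_num) (by norm_num)).mul_left
    (1 / 4)
  convert! h using 1
  · funext j; rw [pow_succ']
  · norm_num

theorem summable_window_prod : Summable fun p : ℕ × ℕ => B.window p.1 p.2 := by
  rw [summable_prod_of_nonneg fun p => B.window_nonneg _ _]
  exact ⟨B.summable_window, .of_nonneg_of_le (fun j => tsum_nonneg (B.window_nonneg j))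
    B.tsum_window_le hasSum_quarter.summable⟩

/-- The coefficients of the test function: the sum of all windows. -/
noncomputable def g (m : ℕ) : ℝ := ∑' j, B.window j m

theorem g_nonneg (m : ℕ) : 0 ≤ B.g m := tsum_nonneg fun j => B.window_nonneg j m

theorem g_eq {j m : ℕ} (h : m ∈ Finset.Ico (B.n j) (2 * B.n j)) : B.g m = B.ρ j ^ m / B.n j := by
  rw [g, tsum_eq_single j]
  · rw [window, if_pos h]
  · intro i hi
    rw [window, if_neg fun h' => hi (B.index_unique h' h)]

theorem g_eq_zero {m : ℕ} (h : ∀ j, m ∉ Finset.Ico (B.n j) (2 * B.n j)) : B.g m = 0 := by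
  rw [g]
  simp_rw [window, if_neg (h _)]
  exact tsum_zero

theorem g_zero : B.g 0 = 0 := B.g_eq_zero fun j h => by
  have := B.n_pos j
  rw [Finset.mem_Ico] at h
  omega

theorem summable_g : Summable B.g := B.summable_window_prod.prod_symm.prod

theorem tsum_g_le : ∑' m, B.g m ≤ 1 / 3 := by
  have h : ∑' m, B.g m = ∑' j, ∑' m, B.window j m :=
    Summable.tsum_comm (f := B.window) B.summable_window_prod
  rw [h, ← hasSum_quarter.tsum_eq]
  exact (B.summable_window_prod.prod).tsum_le_tsum B.tsum_window_le hasSum_quarter.summable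

/-- The matrix entries of multiplication by the test function. -/
noncomputable def entry (m k : ℕ) : ℝ := B.g m * √(B.a k / B.a (m + k))

theorem entry_nonneg (m k : ℕ) : 0 ≤ B.entry m k := mul_nonneg (B.g_nonneg m) (Real.sqrt_nonneg _)

theorem entry_sq (m k : ℕ) : B.entry m k ^ 2 = B.g m ^ 2 * (B.a k / B.a (m + k)) := by
  rw [entry, mul_pow, Real.sq_sqrt (div_nonneg (B.a_pos _).le (B.a_pos _).le)]

/-- The factor `ρ j ^ (2 * m)` in `g m ^ 2` cancels the same factor in the lower bound for `a (m +
k)`. -/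
theorem entry_sq_le_of_lt {j m k : ℕ} (hm : m ∈ Finset.Ico (B.n j) (2 * B.n j)) (hk : k < B.N j) :
    B.entry m k ^ 2 ≤ 1 / (B.n j ^ 2 * B.c j * B.ρ j ^ (2 * B.N j)) := by
  have hρ := B.ρ_pos j
  have hn : (0 : ℝ) < B.n j := by exact_mod_cast B.n_pos j
  have hc := B.c_pos j
  rw [entry_sq, B.g_eq hm]
  have h1 : B.a k / B.a (m + k) ≤ 1 / (B.c j * B.ρ j ^ (2 * (m + k))) :=
    div_le_div₀ zero_le_one (B.a_le_one k) (by positivity) (B.le_a j (m + k))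
  have h2 : B.ρ j ^ (2 * B.N j) ≤ B.ρ j ^ (2 * k) :=
    pow_le_pow_of_le_one hρ.le (B.ρ_lt_one j).le (by omega)
  calc (B.ρ j ^ m / B.n j) ^ 2 * (B.a k / B.a (m + k))
      ≤ (B.ρ j ^ m / B.n j) ^ 2 * (1 / (B.c j * B.ρ j ^ (2 * (m + k)))) := by gcongr
    _ = 1 / (B.n j ^ 2 * B.c j * B.ρ j ^ (2 * k)) := by
        rw [show 2 * (m + k) = m * 2 + 2 * k by ring, pow_add, pow_mul]
        field_simp
    _ ≤ _ := by gcongr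

theorem entry_le_of_mem {j m k : ℕ} (hm : m ∈ Finset.Ico (B.n j) (2 * B.n j)) (hk : B.N j ≤ k) :
    B.entry m k ≤ 2 / B.n j := by
  have hρ := B.ρ_pos j
  have hn : (0 : ℝ) < B.n j := by exact_mod_cast B.n_pos j
  refine (sq_le_sq₀ (B.entry_nonneg _ _) (by positivity)).1 ?_
  have h := B.pow_mul_a_le j k m hk
  have h1 : B.ρ j ^ (2 * m) * (B.a k / B.a (m + k)) ≤ 4 := by
    rw [mul_div_assoc', div_le_iff₀ (B.a_pos _), add_comm m k]
    linarith [B.a_pos (k + m)]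
  rw [entry_sq, B.g_eq hm, div_pow, div_pow, div_mul_eq_mul_div, ← pow_mul, mul_comm m 2]
  norm_num
  gcongr

/-- By the choice of `ρ (j + 1)` close to 1, `ρ (j + 1) ^ (2 * m) ≥ 1/2` for all `m` in the `j`-th
window, so `a k ≤ 4 * a (m + k)`. -/
theorem entry_le_of_ge {j m k : ℕ} (hm : m ∈ Finset.Ico (B.n j) (2 * B.n j))
    (hk : B.N (j + 1) ≤ k) : B.entry m k ≤ 2 * B.g m := by
  have h := B.pow_mul_a_le (j + 1) k m hk
  have h1 : B.ρ (j + 1) ^ (4 * B.n j) ≤ B.ρ (j + 1) ^ (2 * m) :=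
    pow_le_pow_of_le_one (B.ρ_pos _).le (B.ρ_lt_one _).le (by rw [Finset.mem_Ico] at hm; omega)
  have h2 := (B.ρ_pow j).trans h1
  have h3 : B.a k / B.a (m + k) ≤ 2 ^ 2 := by
    rw [div_le_iff₀ (B.a_pos _), add_comm m k]
    nlinarith [B.a_pos k]
  rw [entry, mul_comm]
  exact mul_le_mul_of_nonneg_right (Real.sqrt_le_iff.2 ⟨two_pos.le, h3⟩) (B.g_nonneg m)

end BlockWeight

/-! ### The test function is a multiplier bounded by 1/3 on the disc. -/

namespace BlockWeight

variable (B : BlockWeight)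

/-- The pairs `(m, k)` with `k` before the block that belongs to the window of `m`. -/
def IsLow (m k : ℕ) : Prop := ∃ j, m ∈ Finset.Ico (B.n j) (2 * B.n j) ∧ k < B.N j

/-- The pairs `(m, k)` with `k` in the block that belongs to the window of `m`. -/
def IsMid (m k : ℕ) : Prop :=
  ∃ j, m ∈ Finset.Ico (B.n j) (2 * B.n j) ∧ B.N j ≤ k ∧ k < B.N (j + 1)

open Classical in
theorem summable_entry_low :
    Summable fun p : ℕ × ℕ => (if B.IsLow p.1 p.2 then B.entry p.1 p.2 else 0) ^ 2 := by
  let C : ℕ → ℝ := fun j => 1 / (B.n j ^ 2 * B.c j * B.ρ j ^ (2 * B.N j))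
  have hC : ∀ j, 0 ≤ C j := fun j => by
    have := B.ρ_pos j
    have := B.c_pos j
    simp only [C]
    positivity
  let S : ℕ → Finset (ℕ × ℕ) := fun j =>
    (Finset.Ico (B.n j) (2 * B.n j)) ×ˢ Finset.range (B.N j)
  let q : ℕ → ℕ × ℕ → ℝ := fun j p => if p ∈ S j then C j else 0
  have hq0 : ∀ j p, 0 ≤ q j p := fun j p => by
    simp only [q]
    split_ifs
    exacts [hC j, le_rfl]
  have hqs : ∀ j, HasSum (q j) ((S j).card * C j) := fun j => by
    have h := hasSum_sum_of_ne_finset_zero (f := q j) (s := S j) (L := .unconditional _)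
      fun p hp => if_neg hp
    convert! h using 1
    rw [← nsmul_eq_mul, ← Finset.sum_const]
    exact Finset.sum_congr rfl fun p hp => (if_pos hp).symm
  have hle : ∀ j, (S j).card * C j ≤ 2 * (1 / 4) ^ j := fun j => by
    have hn : (0 : ℝ) < B.n j := by exact_mod_cast B.n_pos j
    have hρ := B.ρ_pos j
    have hc := B.c_pos j
    have h := B.N_le j
    have hcard : ((S j).card : ℝ) = B.n j * B.N j := by
      simp only [S]
      rw [Finset.card_product, card_Ico_n, Finset.card_range, Nat.cast_mul]
    rw [hcard, mul_one_div, div_le_iff₀ (by positivity)]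
    calc (B.n j : ℝ) * B.N j ≤ B.n j * (2 * (1 / 4) ^ j * B.n j * B.c j * B.ρ j ^ (2 * B.N j)) := by
          gcongr
      _ = _ := by ring
  have hprod : Summable fun x : ℕ × (ℕ × ℕ) => q x.1 x.2 := by
    rw [summable_prod_of_nonneg fun x => hq0 x.1 x.2]
    refine ⟨fun j => (hqs j).summable, ?_⟩
    simp only [(hqs _).tsum_eq]
    refine .of_nonneg_of_le (fun j => mul_nonneg (Nat.cast_nonneg _) (hC j)) hle ?_
    exact (summable_geometric_of_lt_one (by norm_num) (by norm_num)).mul_left 2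
  have hsymm := hprod.prod_symm
  refine .of_nonneg_of_le (fun p => sq_nonneg _) (fun p => ?_) hsymm.prod
  split_ifs with h
  · obtain ⟨j, hm, hk⟩ := h
    refine (B.entry_sq_le_of_lt hm hk).trans ?_
    have h1 : q j p = C j := if_pos (Finset.mem_product.2 ⟨hm, Finset.mem_range.2 hk⟩)
    change C j ≤ _
    rw [← h1]
    exact (hsymm.prod_factor p).le_tsum j fun i _ => hq0 i p
  · rw [zero_pow two_ne_zero]
    exact tsum_nonneg fun j => hq0 j p

open Classical in
/-- The entries in the middle region. -/
noncomputable def midEntry (m k : ℕ) : ℝ := if B.IsMid m k then B.entry m k else 0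

theorem isMid_of_midEntry_ne_zero {m k : ℕ} (h : B.midEntry m k ≠ 0) : B.IsMid m k := by
  classical
  by_contra h'
  exact h (if_neg h')

theorem midEntry_le {j m k : ℕ} (hm : m ∈ Finset.Ico (B.n j) (2 * B.n j)) (hk : B.N j ≤ k) :
    B.midEntry m k ≤ 2 / B.n j := by
  classical
  rw [midEntry]
  split_ifs
  · exact B.entry_le_of_mem hm hk
  · positivity

open Classical in
theorem entry_not_low_le (m k : ℕ) :
    (if B.IsLow m k then 0 else B.entry m k) ≤ 2 * B.g m + B.midEntry m k := by
  have hg := B.g_nonneg m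
  have he := B.entry_nonneg m k
  rw [midEntry]
  by_cases hlow : B.IsLow m k
  · rw [if_pos hlow]
    split_ifs <;> linarith
  rw [if_neg hlow]
  split_ifs with hmid
  · linarith
  · rw [add_zero]
    by_cases h : ∃ j, m ∈ Finset.Ico (B.n j) (2 * B.n j)
    · obtain ⟨j, hj⟩ := h
      have h1 : B.N j ≤ k := not_lt.1 fun h => hlow ⟨j, hj, h⟩
      exact B.entry_le_of_ge hj (not_lt.1 fun h => hmid ⟨j, hj, h1, h⟩)
    · have : B.g m = 0 := B.g_eq_zero fun j hj => h ⟨j, hj⟩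
      rw [entry, this]
      simp

theorem sum_midEntry_col_le (k M : ℕ) : ∑ m ∈ Finset.range M, B.midEntry m k ≤ 2 := by
  by_cases h : ∀ m ∈ Finset.range M, B.midEntry m k = 0
  · rw [Finset.sum_eq_zero h]; exact two_pos.le
  push Not at h
  obtain ⟨m₀, _, hm₀⟩ := h
  obtain ⟨j, -, hj1, hj2⟩ := B.isMid_of_midEntry_ne_zero hm₀
  refine Finset.sum_le_of_forall_ne_zero_mem (T := Finset.Ico (B.n j) (2 * B.n j)) two_pos.le
    fun m _ hm => ?_
  obtain ⟨i, hi, hi1, hi2⟩ := B.isMid_of_midEntry_ne_zero hm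
  have hij : i = j := by
    rcases lt_trichotomy i j with h | h | h
    · have := B.N_mono (show i + 1 ≤ j from h); omega
    · exact h
    · have := B.N_mono (show j + 1 ≤ i from h); omega
  subst hij
  rw [card_Ico_n]
  exact ⟨hi, B.midEntry_le hi hi1⟩

theorem sum_midEntry_row_le (l : ℕ) :
    ∑ m ∈ Finset.range (l + 1), B.midEntry m (l - m) ≤ 2 := by
  by_cases h : ∀ m ∈ Finset.range (l + 1), B.midEntry m (l - m) = 0
  · rw [Finset.sum_eq_zero h]; exact two_pos.le
  push Not at h
  obtain ⟨m₀, hml₀, hm₀⟩ := h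
  obtain ⟨j, hj, hj1, hj2⟩ := B.isMid_of_midEntry_ne_zero hm₀
  refine Finset.sum_le_of_forall_ne_zero_mem (T := Finset.Ico (B.n j) (2 * B.n j)) two_pos.le
    fun m hml hm => ?_
  obtain ⟨i, hi, hi1, hi2⟩ := B.isMid_of_midEntry_ne_zero hm
  have hij : i = j := by
    rw [Finset.mem_Ico] at hi hj
    rw [Finset.mem_range] at hml hml₀
    rcases lt_trichotomy i j with h | h | h
    · have := B.N_mono (show i + 1 ≤ j from h)
      have := B.two_mul_n_le h
      omega
    · exact h
    · have := B.N_mono (show j + 1 ≤ i from h)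
      have := B.two_mul_n_le h
      omega
  subst hij
  rw [card_Ico_n]
  exact ⟨hi, B.midEntry_le hi hi1⟩

theorem sum_range_g_le (M : ℕ) : ∑ m ∈ Finset.range M, B.g m ≤ 1 / 3 :=
  (B.summable_g.sum_le_tsum _ fun m _ => B.g_nonneg m).trans B.tsum_g_le

open Finset in
theorem summable_sq_sum_entry {x : ℕ → ℝ} (hx : Summable fun k => x k ^ 2) :
    Summable fun l => (∑ p ∈ antidiagonal l, B.entry p.1 p.2 * x p.2) ^ 2 := by
  classical
  have h1 := summable_sq_sum_of_hilbertSchmidt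
    (Q := fun m k => if B.IsLow m k then B.entry m k else 0) B.summable_entry_low hx
  have h2 := summable_sq_sum_of_schur (R := 3)
    (P := fun m k => if B.IsLow m k then 0 else B.entry m k) (fun m k => by
      split_ifs
      exacts [le_rfl, B.entry_nonneg m k])
    (fun l => by
      rw [Nat.sum_antidiagonal_eq_sum_range_succ
        (fun m k => if B.IsLow m k then 0 else B.entry m k)]
      refine (sum_le_sum fun m _ => B.entry_not_low_le m (l - m)).trans ?_
      rw [sum_add_distrib, ← mul_sum]
      have h1 := B.sum_range_g_le (l + 1)
      have h2 := B.sum_midEntry_row_le l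
      rw [Nat.succ_eq_add_one]
      linarith)
    (fun k M => by
      refine (sum_le_sum fun m _ => B.entry_not_low_le m k).trans ?_
      rw [sum_add_distrib, ← mul_sum]
      have h1 := B.sum_range_g_le M
      have h2 := B.sum_midEntry_col_le k M
      linarith) hx
  refine .of_nonneg_of_le (fun l => sq_nonneg _) (fun l => ?_) ((h1.add h2).mul_left 2)
  have : ∑ p ∈ antidiagonal l, B.entry p.1 p.2 * x p.2 =
      ∑ p ∈ antidiagonal l, (if B.IsLow p.1 p.2 then B.entry p.1 p.2 else 0) * x p.2 +
      ∑ p ∈ antidiagonal l, (if B.IsLow p.1 p.2 then 0 else B.entry p.1 p.2) * x p.2 := by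
    rw [← sum_add_distrib]
    refine sum_congr rfl fun p _ => ?_
    split_ifs <;> ring
  rw [this]
  exact add_sq_le

/-- The Hilbert function space of a block weight. -/
abbrev Space : Type := WeightedHardy B.toSummableWeight

theorem summable_norm_g : Summable fun n => ‖(B.g n : ℂ)‖ := by
  simpa [abs_of_nonneg (B.g_nonneg _)] using B.summable_g

open Finset in
theorem g_mem_multiplierSubalgebra :
    (fun z : ClosedDisc => ∑' n, (B.g n : ℂ) * (z : ℂ) ^ n) ∈ multiplierSubalgebra B.Space := by
  intro f
  have hsq : ∀ k, (‖f.coeff k‖ / √(B.a k)) ^ 2 = ‖f.coeff k‖ ^ 2 / B.a k := fun k => by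
    rw [div_pow, Real.sq_sqrt (B.a_pos k).le]
  have hx : Summable fun k => (‖f.coeff k‖ / √(B.a k)) ^ 2 := by
    simp_rw [hsq]
    exact f.hasSum_norm_coeff_sq.summable
  have hsum : Summable fun n =>
      ‖∑ p ∈ antidiagonal n, (B.g p.1 : ℂ) * f.coeff p.2‖ ^ 2 / B.toSummableWeight.a n := by
    refine .of_nonneg_of_le (fun n => div_nonneg (sq_nonneg _) (B.a_pos n).le) (fun n => ?_)
      (B.summable_sq_sum_entry hx)
    have h1 : ∑ p ∈ antidiagonal n, B.entry p.1 p.2 * (‖f.coeff p.2‖ / √(B.a p.2)) =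
        (∑ p ∈ antidiagonal n, B.g p.1 * ‖f.coeff p.2‖) / √(B.a n) := by
      rw [sum_div]
      refine sum_congr rfl fun p hp => ?_
      have h2 : 0 < √(B.a p.2) := Real.sqrt_pos.2 (B.a_pos _)
      rw [entry, HasAntidiagonal.mem_antidiagonal.1 hp, Real.sqrt_div (B.a_pos _).le]
      field_simp
    rw [h1, div_pow, Real.sq_sqrt (B.a_pos n).le]
    refine div_le_div_of_nonneg_right (pow_le_pow_left₀ (norm_nonneg _) ?_ 2) (B.a_pos n).le
    refine (norm_sum_le _ _).trans (le_of_eq (sum_congr rfl fun p _ => ?_))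
    rw [norm_mul, Complex.norm_real, Real.norm_eq_abs, abs_of_nonneg (B.g_nonneg _)]
  obtain ⟨h, hh⟩ := WeightedHardy.exists_coeff_eq _ hsum
  exact ⟨h, (WeightedHardy.forall_apply_eq_mul_iff B.summable_norm_g h f).2 fun n => by rw [hh]⟩

/-- The test function as a multiplier. -/
noncomputable def gMult : Mult B.Space := ⟨_, B.g_mem_multiplierSubalgebra⟩

theorem gMult_apply (z : ClosedDisc) : B.gMult z = ∑' n, (B.g n : ℂ) * (z : ℂ) ^ n := rfl

theorem norm_gMult_apply_le (z : ClosedDisc) : ‖B.gMult z‖ ≤ 1 / 3 := by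
  rw [gMult_apply]
  refine (tsum_of_norm_bounded B.summable_g.hasSum fun n => ?_).trans B.tsum_g_le
  rw [norm_mul, Complex.norm_real, Real.norm_eq_abs, abs_of_nonneg (B.g_nonneg _)]
  exact mul_le_of_le_one_right (B.g_nonneg n) (z.norm_pow_le_one n)

theorem le_norm_one_sub_gMult_apply (z : ClosedDisc) : 2 / 3 ≤ ‖(1 - B.gMult : Mult B.Space) z‖ := by
  change 2 / 3 ≤ ‖1 - B.gMult z‖
  have h1 := norm_sub_norm_le 1 (B.gMult z)
  have h2 := B.norm_gMult_apply_le z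
  rw [norm_one] at h1
  linarith

end BlockWeight

open Finset in
theorem PowerSeries.coeff_inv_one_sub_nonneg {g : ℕ → ℝ} (hg : ∀ n, 0 ≤ g n) (h0 : g 0 = 0)
    (n : ℕ) : 0 ≤ coeff n (1 - mk g)⁻¹ := by
  have hinv : (1 - mk g) * (1 - mk g)⁻¹ = 1 := PowerSeries.mul_inv_cancel _ (by simp [h0])
  have hrec : (1 - mk g)⁻¹ = 1 + mk g * (1 - mk g)⁻¹ := by
    linear_combination hinv
  induction n using Nat.strong_induction_on with
  | _ n ih =>
    rw [hrec, map_add, coeff_one, coeff_mul]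
    refine add_nonneg (by split_ifs <;> norm_num) (sum_nonneg fun p hp => ?_)
    rw [coeff_mk]
    rcases Nat.eq_zero_or_pos p.1 with h | h
    · rw [h, h0, zero_mul]
    · have := HasAntidiagonal.mem_antidiagonal.1 hp
      exact mul_nonneg (hg _) (ih _ (by omega))

namespace WeightedHardy

variable {w : SummableWeight}

theorem exists_polynomial (S : Finset ℕ) (u : ℕ → ℂ) :
    ∃ f : WeightedHardy w, f.coeff = fun n => if n ∈ S then u n else 0 :=
  exists_coeff_eq _ (summable_of_ne_finset_zero (s := S) fun n hn => by simp [hn])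

theorem norm_sq_eq_sum {f : WeightedHardy w} {S : Finset ℕ} (hf : ∀ n ∉ S, f.coeff n = 0) :
    ‖f‖ ^ 2 = ∑ n ∈ S, ‖f.coeff n‖ ^ 2 / w.a n :=
  f.hasSum_norm_coeff_sq.unique (hasSum_sum_of_ne_finset_zero fun n hn => by simp [hf n hn])

theorem sum_le_norm_sq (f : WeightedHardy w) (S : Finset ℕ) :
    ∑ n ∈ S, ‖f.coeff n‖ ^ 2 / w.a n ≤ ‖f‖ ^ 2 :=
  sum_le_hasSum S (fun n _ => div_nonneg (sq_nonneg _) (w.a_pos n).le) f.hasSum_norm_coeff_sq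

open Finset in
theorem exists_mult_eq_coe (hr : Filter.Tendsto (fun n => w.a n / w.a (n + 1)) Filter.atTop
    (nhds 1)) : ∃ φ : Mult (WeightedHardy w), ∀ z : ClosedDisc, φ z = z := by
  have hz : ∀ z : ClosedDisc, ∑' n, (Pi.single 1 1 : ℕ → ℂ) n * (z : ℂ) ^ n = z := fun z => by
    rw [tsum_eq_single 1 fun n hn => by simp [hn]]
    simp
  have hs : Summable fun n => ‖(Pi.single 1 1 : ℕ → ℂ) n‖ :=
    summable_of_ne_finset_zero (s := {1}) fun n hn => by
      have : n ≠ 1 := by simpa using hn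
      simp [this]
  obtain ⟨C, hC⟩ := hr.bddAbove_range
  refine ⟨⟨fun z => z, fun f => ?_⟩, fun z => rfl⟩
  have hu : Summable fun n => ‖(if n = 0 then 0 else f.coeff (n - 1) : ℂ)‖ ^ 2 / w.a n := by
    rw [← summable_nat_add_iff 1]
    refine .of_nonneg_of_le (fun n => div_nonneg (sq_nonneg _) (w.a_pos _).le) (fun n => ?_)
      (f.hasSum_norm_coeff_sq.summable.mul_left C)
    have h1 : w.a n ≤ C * w.a (n + 1) := (div_le_iff₀ (w.a_pos _)).1 (hC ⟨n, rfl⟩)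
    simp only [Nat.add_eq_zero_iff, one_ne_zero, and_false, if_false, Nat.add_sub_cancel]
    rw [mul_div_assoc', div_le_div_iff₀ (w.a_pos _) (w.a_pos _)]
    nlinarith [sq_nonneg ‖f.coeff n‖]
  obtain ⟨h, hh⟩ := exists_coeff_eq _ hu
  refine ⟨h, fun z => ?_⟩
  have := (forall_apply_eq_mul_iff hs h f).2 (fun n => ?_) z
  · rwa [hz] at this
  rw [hh, Nat.sum_antidiagonal_eq_sum_range_succ (fun i j => (Pi.single 1 1 : ℕ → ℂ) i * f.coeff j)]
  cases n with
  | zero => simp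
  | succ n =>
    rw [sum_eq_single 1]
    · simp
    · intro i _ hi
      simp [hi]
    · simp

end WeightedHardy

namespace BlockWeight

variable (B : BlockWeight)

theorem one_sub_gMult_apply_ne_zero (z : ClosedDisc) : (1 - B.gMult : Mult B.Space) z ≠ 0 := by
  intro h
  have := B.le_norm_one_sub_gMult_apply z
  rw [h, norm_zero] at this
  norm_num at this

open Finset in
theorem bound_of_inverse (ψ : Mult B.Space) (hψ : ∀ z, ψ z = 1 / (1 - B.gMult : Mult B.Space) z)
    (j : ℕ) : ((j : ℝ) + 1) ≤ 6 * ‖ψ‖ ^ 2 := by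
  obtain ⟨fψ, hfψ⟩ := WeightedHardy.exists_eq_mult ψ
  set G : PowerSeries ℝ := PowerSeries.mk B.g with hG
  have hinv : (1 - G)⁻¹ * (1 - G) = 1 := PowerSeries.inv_mul_cancel _ (by simp [hG, B.g_zero])
  have hΨ0 : ∀ n, 0 ≤ PowerSeries.coeff n (1 - G)⁻¹ :=
    PowerSeries.coeff_inv_one_sub_nonneg B.g_nonneg B.g_zero
  have hcoef : ∀ n, fψ.coeff n = (PowerSeries.coeff n (1 - G)⁻¹ : ℝ) := by
    let u : ℕ → ℂ := fun n => (PowerSeries.coeff n (1 - G) : ℝ)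
    have hu_eq : ∀ n, u n = (Pi.single 0 1 : ℕ → ℂ) n - B.g n := fun n => by
      simp only [u, hG, map_sub, PowerSeries.coeff_one, PowerSeries.coeff_mk, Pi.single_apply]
      split_ifs <;> simp
    have hs1 : Summable fun n => ‖(Pi.single 0 1 : ℕ → ℂ) n‖ :=
      summable_of_ne_finset_zero (s := {0}) fun n hn => by
        have : n ≠ 0 := by simpa using hn
        simp [this]
    have hu : Summable fun n => ‖u n‖ := by
      refine .of_nonneg_of_le (fun n => norm_nonneg _) (fun n => ?_) (hs1.add B.summable_norm_g)
      rw [hu_eq]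
      exact norm_sub_le _ _
    have huz : ∀ z : ClosedDisc, ∑' n, u n * (z : ℂ) ^ n = (1 - B.gMult : Mult B.Space) z :=
      fun z => by
        simp_rw [hu_eq, sub_mul]
        rw [((z.summable_mul_pow hs1).of_norm).tsum_sub (z.summable_mul_pow B.summable_norm_g).of_norm,
          tsum_eq_single 0 fun n hn => by simp [hn]]
        simp only [Pi.single_eq_same, pow_zero, mul_one]
        rfl
    have h1 := (WeightedHardy.forall_apply_eq_mul_iff hu (WeightedHardy.monomial 0) fψ).1
      fun z => by
        rw [huz, hfψ, hψ, mul_one_div_cancel (B.one_sub_gMult_apply_ne_zero z), WeightedHardy.monomial_apply, pow_zero]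
    have h2 : (1 - G).map Complex.ofRealHom * PowerSeries.mk fψ.coeff = 1 := by
      ext n
      rw [PowerSeries.coeff_mul]
      have := h1 n
      rw [WeightedHardy.coeff_monomial] at this
      rw [PowerSeries.coeff_one, ← Pi.single_apply, this]
      refine sum_congr rfl fun p _ => ?_
      rw [PowerSeries.coeff_mk, PowerSeries.coeff_map]
      rfl
    have h3 : ((1 - G)⁻¹).map Complex.ofRealHom * (1 - G).map Complex.ofRealHom = 1 := by
      rw [← map_mul, hinv, map_one]
    have h4 := left_inv_eq_right_inv h3 h2
    intro n
    have := congrArg (PowerSeries.coeff n) h4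
    rw [PowerSeries.coeff_mk, PowerSeries.coeff_map] at this
    exact this.symm
  have hψz : ∀ z, ψ z = ∑' n, fψ.coeff n * (z : ℂ) ^ n := fun z => by
    rw [← hfψ, WeightedHardy.apply_eq_tsum]
  have hρ := B.ρ_pos j
  have hc := B.c_pos j
  have hn : (0 : ℝ) < B.n j := by exact_mod_cast B.n_pos j
  set J := Ico (B.N j) (B.N j + (j + 1) * B.n j) with hJ
  set J' := Ico (B.N j) (B.N j + 2 * B.n j) with hJ'
  let f : ℕ → ℝ := fun k => if k ∈ J then B.ρ j ^ k else 0
  let e : ℕ → ℝ := fun k => if k ∈ J' then B.ρ j ^ k else 0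
  have hf0 : ∀ k, 0 ≤ f k := fun k => by simp only [f]; split_ifs <;> positivity
  have he0 : ∀ k, 0 ≤ e k := fun k => by simp only [e]; split_ifs <;> positivity
  have hdiff : ∀ l, 0 ≤ PowerSeries.coeff l (PowerSeries.mk e - (1 - G) * PowerSeries.mk f) :=
    fun l => by
      have h1 : PowerSeries.mk e - (1 - G) * PowerSeries.mk f =
          PowerSeries.mk e - PowerSeries.mk f + G * PowerSeries.mk f := by ring
      rw [h1, map_add, map_sub, PowerSeries.coeff_mul, PowerSeries.coeff_mk, PowerSeries.coeff_mk]
      simp only [hG, PowerSeries.coeff_mk]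
      have hnn : 0 ≤ ∑ p ∈ antidiagonal l, B.g p.1 * f p.2 :=
        sum_nonneg fun p _ => mul_nonneg (B.g_nonneg _) (hf0 _)
      by_cases hl : l ∈ J
      · by_cases hl' : l ∈ J'
        · have : e l = f l := by simp only [e, f, if_pos hl, if_pos hl']
          rw [this]
          linarith
        · have hle : f l ≤ ∑ p ∈ antidiagonal l, B.g p.1 * f p.2 := by
            rw [Nat.sum_antidiagonal_eq_sum_range_succ (fun m k => B.g m * f k)]
            rw [hJ, mem_Ico] at hl
            rw [hJ', mem_Ico] at hl'
            have hsub : Ico (B.n j) (2 * B.n j) ⊆ range l.succ := fun m hm => by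
              rw [mem_Ico] at hm
              rw [mem_range]
              omega
            refine le_trans (le_of_eq ?_) (sum_le_sum_of_subset_of_nonneg hsub
              fun m _ _ => mul_nonneg (B.g_nonneg _) (hf0 _))
            have hterm : ∀ m ∈ Ico (B.n j) (2 * B.n j), B.g m * f (l - m) = B.ρ j ^ l / B.n j :=
              fun m hm => by
                have hm' := mem_Ico.1 hm
                have h2 : f (l - m) = B.ρ j ^ (l - m) := if_pos (by
                  rw [hJ, mem_Ico]
                  constructor <;> omega)
                rw [B.g_eq hm, h2, div_mul_eq_mul_div, ← pow_add]
                congr 2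
                omega
            rw [sum_congr rfl hterm, sum_const, card_Ico_n, nsmul_eq_mul, mul_div_cancel₀ _ hn.ne']
            exact if_pos (by rw [hJ, mem_Ico]; exact hl)
          linarith [he0 l]
      · have : f l = 0 := if_neg hl
        rw [this]
        linarith [he0 l]
  have hfle : ∀ l, f l ≤ PowerSeries.coeff l ((1 - G)⁻¹ * PowerSeries.mk e) := fun l => by
    have h1 : (1 - G)⁻¹ * PowerSeries.mk e = PowerSeries.mk f +
        (1 - G)⁻¹ * (PowerSeries.mk e - (1 - G) * PowerSeries.mk f) := by
      linear_combination PowerSeries.mk f * hinv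
    rw [h1, map_add, PowerSeries.coeff_mk, PowerSeries.coeff_mul]
    have := sum_nonneg fun p (_ : p ∈ antidiagonal l) => mul_nonneg (hΨ0 p.1) (hdiff p.2)
    linarith
  obtain ⟨E, hE⟩ := WeightedHardy.exists_polynomial (w := B.toSummableWeight) J'
    fun k => (B.ρ j : ℂ) ^ k
  have hEe : ∀ k, E.coeff k = (e k : ℝ) := fun k => by
    rw [hE]
    simp only [e]
    split_ifs <;> simp
  have hprod : ∀ l, (ψ.mulOp E).coeff l =
      (PowerSeries.coeff l ((1 - G)⁻¹ * PowerSeries.mk e) : ℝ) := by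
    have h1 := (WeightedHardy.forall_apply_eq_mul_iff fψ.summable_norm_coeff (ψ.mulOp E) E).1
      fun z => by rw [Mult.mulOp_apply, hψz]
    intro l
    rw [h1, PowerSeries.coeff_mul]
    push_cast
    refine sum_congr rfl fun p _ => ?_
    rw [hcoef, hEe, PowerSeries.coeff_mk]
  have hlow : ((j : ℝ) + 1) * B.n j / (3 * B.c j) ≤ ‖ψ.mulOp E‖ ^ 2 := by
    refine le_trans ?_ (WeightedHardy.sum_le_norm_sq (ψ.mulOp E) J)
    have hcard : (J.card : ℝ) = (j + 1) * B.n j := by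
      rw [hJ, Nat.card_Ico, Nat.add_sub_cancel_left]
      push_cast
      rfl
    rw [← hcard, div_eq_mul_one_div, ← nsmul_eq_mul]
    refine card_nsmul_le_sum _ _ _ fun k hk => ?_
    have h1 : f k = B.ρ j ^ k := if_pos hk
    have h2 : B.ρ j ^ k ≤ ‖(ψ.mulOp E).coeff k‖ := by
      rw [hprod, Complex.norm_real, ← h1]
      exact (hfle k).trans (le_abs_self _)
    rw [hJ, mem_Ico] at hk
    have h3 := B.a_le j k hk.1 hk.2.le
    change _ ≤ _ / B.a k
    rw [div_le_div_iff₀ (by positivity) (B.a_pos k), one_mul]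
    calc B.a k ≤ 3 * (B.c j * B.ρ j ^ (2 * k)) := h3
      _ = (B.ρ j ^ k) ^ 2 * (3 * B.c j) := by rw [← pow_mul, mul_comm k 2]; ring
      _ ≤ _ := by gcongr
  have hup : ‖E‖ ^ 2 ≤ 2 * B.n j / B.c j := by
    rw [WeightedHardy.norm_sq_eq_sum (S := J') fun k hk => by rw [hEe]; simp [e, hk]]
    have hcard : (J'.card : ℝ) = 2 * B.n j := by
      rw [hJ', Nat.card_Ico, Nat.add_sub_cancel_left]
      push_cast
      rfl
    rw [← hcard, div_eq_mul_one_div (J'.card : ℝ), ← nsmul_eq_mul]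
    refine sum_le_card_nsmul _ _ _ fun k hk => ?_
    have h1 : e k = B.ρ j ^ k := if_pos hk
    have h3 := B.le_a j k
    rw [hEe, h1, Complex.norm_real, Real.norm_eq_abs, sq_abs]
    change _ / B.a k ≤ _
    rw [div_le_div_iff₀ (B.a_pos k) hc, one_mul, ← pow_mul, mul_comm k 2]
    linarith
  have hop : ‖ψ.mulOp E‖ ^ 2 ≤ ‖ψ‖ ^ 2 * ‖E‖ ^ 2 := by
    rw [← mul_pow]
    exact pow_le_pow_left₀ (norm_nonneg _) (ψ.mulOp.le_opNorm E) 2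
  have hfin : ((j : ℝ) + 1) * B.n j / (3 * B.c j) ≤ ‖ψ‖ ^ 2 * (2 * B.n j / B.c j) :=
    hlow.trans (hop.trans (by gcongr))
  rw [div_le_iff₀ (by positivity)] at hfin
  have h5 : ‖ψ‖ ^ 2 * (2 * B.n j / B.c j) * (3 * B.c j) = 6 * ‖ψ‖ ^ 2 * B.n j := by
    field_simp
    ring
  rw [h5] at hfin
  exact le_of_mul_le_mul_right hfin hn

theorem not_exists_inverse :
    ¬ ∃ ψ : Mult B.Space, ∀ z, ψ z = 1 / (1 - B.gMult : Mult B.Space) z := by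
  rintro ⟨ψ, hψ⟩
  obtain ⟨j, hj⟩ := exists_nat_gt (6 * ‖ψ‖ ^ 2)
  have := B.bound_of_inverse ψ hψ j
  linarith

theorem not_oneFunctionCorona : ¬ OneFunctionCorona B.Space := fun h =>
  B.not_exists_inverse (h (1 - B.gMult) (lt_of_lt_of_le (by norm_num)
    (le_ciInf fun z => B.le_norm_one_sub_gMult_apply z)))

end BlockWeight

theorem theorem1p6 :
    ∃ (H : Type) (_ : NormedAddCommGroup H) (_ : InnerProductSpace ℂ H) (_ : CompleteSpace H)
      (_ : RKHS ℂ H ClosedDisc ℂ) (a : ℕ → ℝ),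
      a 0 = 1 ∧ (∀ n, 0 < a n) ∧
      Filter.Tendsto (fun n => a n / a (n + 1)) Filter.atTop (nhds 1) ∧
      Summable a ∧
      (∀ z w : ClosedDisc, HasSum (fun n => (a n : ℂ) * ((z : ℂ) * star (w : ℂ)) ^ n)
        (scalarKernel H z w)) ∧
      IsCompletePick H ∧
      IsMaximalDomain H ∧
      ¬ OneFunctionCorona H ∧
      ∃ ev : ClosedDisc → MaximalIdealSpace H,
        (∀ (z : ClosedDisc) (φ : Mult H), ev z φ = φ z) ∧
        Topology.IsEmbedding ev ∧ IsCompact (Set.range ev) ∧ Set.range ev ≠ Set.univ := by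
  obtain ⟨B⟩ := exists_blockWeight
  obtain ⟨b, hb0, hb, hab⟩ := exists_renewal_of_logConvex B.a_zero B.a_pos B.a_logConvex
  obtain ⟨φ, hφ⟩ := WeightedHardy.exists_mult_eq_coe (w := B.toSummableWeight) B.a_ratio
  have hemb := WeightedHardy.isEmbedding_evalCharacter φ hφ
  refine ⟨B.Space, inferInstance, inferInstance, inferInstance, inferInstance, B.a, B.a_zero,
    B.a_pos, B.a_ratio, B.a_summable, WeightedHardy.hasSum_scalarKernel,
    WeightedHardy.isCompletePick_of_renewal hb hb0 hab, WeightedHardy.isMaximalDomain B.a_ratio,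
    B.not_oneFunctionCorona, Mult.evalCharacter WeightedHardy.exists_apply_ne_zero,
    Mult.evalCharacter_apply _, hemb, isCompact_range hemb.continuous, fun huniv => ?_⟩
  obtain ⟨χ, hχ⟩ := Mult.exists_character_eq_zero WeightedHardy.exists_apply_ne_zero
    (1 - B.gMult) B.not_exists_inverse B.one_sub_gMult_apply_ne_zero
  obtain ⟨z, rfl⟩ : χ ∈ Set.range _ := huniv ▸ Set.mem_univ χ
  exact B.one_sub_gMult_apply_ne_zero z hχ
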